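/- **Setting.** Let $1<\Gamma\le 2$. For a primitive state $V=(\rho,u,v,p)$ with $\rho,p>0$, $u^2+v^2<1$ put $$W=(1-u^2-v^2)^{-1/2},\quad e=\tfrac{p}{(\Gamma-1)\rho},\quad h=1+e+\tfrac p\rho,\quad c_s^2=\tfrac{\Gamma p}{\rho h},\quad H=1-u^2-v^2c_s^2,$$ $D=\rho W$, $U=(D,\,DhWu,\,DhWv,\,DhW-p)$, $F_1=(Du,\,DhWu^2+p,\,DhWuv,\,DhWu)$, and $$\lambda_4=\frac{u(1-c_s^2)+c_sW^{-1}H^{1/2}}{1-(u^2+v^2)c_s^2}.$$ Consider the quasi-1D generalized Riemann problem $U_t+F_1(U)_x=k$ with a constant source $k=(k_1,k_2,k_3,k_4)$, centred at $x=0$, $t=0$, whose initial state for $x\ge 0$ is $V_0(x)$, with $V_b:=V_0(0)$ and one-sided slope $V_b':=V_0'(0^+)$. The primitive form is $V_t+\widetilde A(V)V_x=C$ with $C=(C_1,C_2,C_3,C_4)$, $$C_4=\tfrac{1}{1-(u^2+v^2)c_s^2}\Big[k_4(\Gamma-1+(u^2+v^2)c_s^2)-\tfrac{\Gamma-1}{W}k_1-(c_s^2+\Gamma-1)(uk_2+vk_3)\Big],$$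 $$C_2=\tfrac{k_2-uk_4-uC_4}{\rho hW^2},\qquad C_3=\tfrac{k_3-vk_4-vC_4}{\rho hW^2},\qquad C_1=\tfrac{k_1}{W}-W^2\rho(uC_2+vC_3),$$ and, with $N=1-(u^2+v^2)c_s^2$, $$\widetilde A=uI_4+\begin{pmatrix}0&\frac{\rho}{N}&0&\frac{-u}{W^2hN}\\0&\frac{-uc_s^2}{W^2N}&0&\frac{H}{\rho hW^2N}\\0&\frac{-vc_s^2}{W^2N}&0&\frac{-uv(1-c_s^2)}{\rho hW^2N}\\0&\frac{\rho hc_s^2}{N}&0&\frac{-uc_s^2}{W^2N}\end{pmatrix}.$$ Let a local solution ($0\le t<T$) be given which has the following structure. A left wave of any kind has trailing edge $x=X_l(t)$; a contact discontinuity is $x=X_c(t)$; a right shock is $x=X_s(t)$; all three curves start at the origin, $X_l<X_c<X_s$ for $t>0$, $X_l$ is continuous and $X_c,X_s$ are $C^1$ on $[0,T)$. In each of the regions $X_l<x<X_c$, $X_c<x<X_s$ and $X_s<x<R$ (where $R>X_s$ is a constant) the solution has $\rho,p>0$, $u^2+v^2<1$, is $C^1$ up to the boundary (origin included) and satisfies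 the equation, and it takes the data $V_0$ on $t=0$, $0\le x<R$. Across the contact $u,p$ are continuous and $X_c'=u$. Across the shock, for every $t\in[0,T)$, with $\sigma=X_s'(t)$, $V$ the state behind and $\bar V$ the state ahead, the right-shock conditions hold: $F_1(U)-F_1(\bar U)=\sigma(U-\bar U)$, $u<\sigma<\lambda_4(V)$ and $\lambda_4(\bar V)<\sigma$. Let $s=X_s'(0)$, and let $V_*$ be the limit at the origin of the solution in $X_c<x<X_s$. **Coefficients $A_u,A_p,A_{rhs}$.** Quantities without subscript are taken at $V_*$, those with subscript $b$ at $V_b$; $[q]=q-q_b$. Put $h_\rho=-\frac{\Gamma}{\Gamma-1}\frac{p}{\rho^2}$, $h_p=\frac{\Gamma}{\Gamma-1}\frac1\rho$ (and likewise $h_{b\rho},h_{bp}$ at $V_b$), and let $$\mathcal T_\rho=2hh_\rho-[p]\Big(\frac{h_\rho}{\rho}-\frac{h}{\rho^2}\Big),\quad \mathcal T_p=2hh_p-\Big(\frac h\rho+\frac{h_b}{\rho_b}\Big)-[p]\frac{h_p}{\rho},$$ $$\mathcal T_{\rho_b}=-2h_bh_{b\rho}-[p]\Big(\frac{h_{b\rho}}{\rho_b}-\frac{h_b}{\rho_b^2}\Big),\quad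 \mathcal T_{p_b}=-2h_bh_{bp}+\Big(\frac h\rho+\frac{h_b}{\rho_b}\Big)-[p]\frac{h_{bp}}{\rho_b}$$ be the partial derivatives of $h^2-h_b^2-(h/\rho+h_b/\rho_b)[p]$. Let $$\psi_W=-\frac{[p]}{\rho W^2}+[u]hu,\quad \psi_h=[u]Wu-\psi_W\frac{Wv^2}{h(1-u^2)},\quad \psi_\rho=-\frac{[p]}{\rho^2W}+\psi_hh_\rho,\quad \theta=\frac{\psi_W\,v}{h(1-u^2)},$$ $$\psi_{W_b}=\frac{[p]}{\rho_bW_b^2}-[u]h_bu_b+\theta h_bv_b,\qquad \psi_{h_b}=-[u]W_bu_b+\theta W_bv_b.$$ Then $$A_u=[hWu]+[u]hW+\psi_W\frac{uW}{1-u^2},\qquad A_p=\Big[\frac1{\rho W}\Big]+\psi_hh_p-\psi_\rho\frac{\mathcal T_p}{\mathcal T_\rho},$$ $$A_{rhs}=-\big(B_\rho Y_1+B_uY_2+B_vY_3+B_pY_4\big),\qquad Y=C(V_b)+\big(sI-\widetilde A(V_b)\big)V_b',$$ $$B_\rho=\frac{[p]}{\rho_b^2W_b}-\psi_\rho\frac{\mathcal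 T_{\rho_b}}{\mathcal T_\rho}+\psi_{h_b}h_{b\rho},\qquad B_u=-[hWu]-[u]h_bW_b+\psi_{W_b}W_b^3u_b,$$ $$B_v=\theta h_bW_b+\psi_{W_b}W_b^3v_b,\qquad B_p=-\Big[\frac1{\rho W}\Big]-\psi_\rho\frac{\mathcal T_{p_b}}{\mathcal T_\rho}+\psi_{h_b}h_{bp}.$$ (The relation $A_u\frac{Du}{Ds}+A_p\frac{Dp}{Ds}=A_{rhs}$, $\frac{D}{Ds}=\partial_t+s\partial_x$, is the Rankine–Hugoniot relation $[p][1/(\rho W)]+[u][hWu]=0$ differentiated along the shock, with $\rho$ and $v$ behind the shock eliminated; $Y$ is the derivative along the shock of the state ahead.) **Statement.** With $\frac{D}{Dt}=\partial_t+u\partial_x$, the limits $(Du/Dt)_*$ and $(Dp/Dt)_*$ of $Du/Dt$ and $Dp/Dt$ at the origin exist in both parts $X_l<x<X_c$ and $X_c<x<X_s$ of the star region, agree in the two parts, and satisfy $$a_R\Big(\frac{Du}{Dt}\Big)_*+b_R\Big(\frac{Dp}{Dt}\Big)_*=d_R,$$ where, all unmarked quantities being taken at $V_*$, $$A_{us}=uC_2+\frac{H}{\rho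 hc_s^2}C_4,\qquad A_{ps}=\rho hW^2C_2+uC_4,$$ $$a_R=A_u+\frac{u-s}{1-us}\rho hW^2A_p,\qquad b_R=A_p+\frac{u-s}{1-us}\frac{H}{\rho hc_s^2}A_u,$$ $$d_R=\frac{1-u^2}{1-us}A_{rhs}+\frac{u-s}{1-us}\big(A_{us}A_u+A_{ps}A_p\big).$$ The same holds for every other way of writing the differentiated shock relation: if $\Psi(u,p,\bar V)$ vanishes for all right shocks $(V,\bar V,\sigma)$ near $(V_*,V_b,s)$ ($u,p$ taken from the state $V$ behind the shock) and is differentiable at $(u_*,p_*,V_b)$, the linear relation holds with $A_u,A_p,A_{rhs}$ replaced by $\partial_u\Psi$, $\partial_p\Psi$ and $-\partial_{\bar V}\Psi\cdot Y$ at that point. -/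

import Mathlib

open Set Filter Topology

noncomputable section

namespace RHD

/-- Primitive variables `(ρ, u, v, p)` of the planar flow, also used for the four components of a
conserved vector, a flux or a source term. -/
abbrev State := Fin 4 → ℝ

/-- Physically admissible primitive states: positive density and pressure, subluminal velocity. -/
def Admissible (V : State) : Prop := 0 < V 0 ∧ 0 < V 3 ∧ V 1 ^ 2 + V 2 ^ 2 < 1

/-- The Lorentz factor `W`. -/
def lorentz (V : State) : ℝ := 1 / Real.sqrt (1 - (V 1 ^ 2 + V 2 ^ 2))

/-- The specific internal energy `e`, from the equation of state `p = (Γ - 1) ρ e`. -/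
def internalEnergy (Γ : ℝ) (V : State) : ℝ := V 3 / ((Γ - 1) * V 0)

/-- The specific enthalpy `h = 1 + e + p / ρ`. -/
def enthalpy (Γ : ℝ) (V : State) : ℝ := 1 + internalEnergy Γ V + V 3 / V 0

/-- The squared sound speed `c_s² = Γ p / (ρ h)`. -/
def soundSq (Γ : ℝ) (V : State) : ℝ := Γ * V 3 / (V 0 * enthalpy Γ V)

/-- `H = 1 - u² - v² c_s²`. -/
def bigH (Γ : ℝ) (V : State) : ℝ := 1 - V 1 ^ 2 - V 2 ^ 2 * soundSq Γ V

/-- The conserved vector `U = (D, D h W u, D h W v, D h W - p)` with `D = ρ W`. -/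
def conserved (Γ : ℝ) (V : State) : State :=
  ![V 0 * lorentz V,
    V 0 * lorentz V * enthalpy Γ V * lorentz V * V 1,
    V 0 * lorentz V * enthalpy Γ V * lorentz V * V 2,
    V 0 * lorentz V * enthalpy Γ V * lorentz V - V 3]

/-- The flux in the `x`-direction, `F₁ = (D u, m₁ u + p, m₂ u, m₁)`. -/
def flux (Γ : ℝ) (V : State) : State :=
  ![conserved Γ V 0 * V 1,
    conserved Γ V 1 * V 1 + V 3,
    conserved Γ V 2 * V 1,
    conserved Γ V 1]

/-- The largest characteristic speed `λ₄`. -/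
def lamFour (Γ : ℝ) (V : State) : ℝ :=
  (V 1 * (1 - soundSq Γ V) +
      Real.sqrt (soundSq Γ V) * (lorentz V)⁻¹ * Real.sqrt (bigH Γ V)) /
    (1 - (V 1 ^ 2 + V 2 ^ 2) * soundSq Γ V)

/-- The matrix of the quasilinear form `V_t + A(V) V_x = C` of the system. -/
def primMatrix (Γ : ℝ) (V : State) : Matrix (Fin 4) (Fin 4) ℝ :=
  V 1 • (1 : Matrix (Fin 4) (Fin 4) ℝ) +
    !![0, V 0 / (1 - (V 1 ^ 2 + V 2 ^ 2) * soundSq Γ V), 0,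
        -V 1 / (lorentz V ^ 2 * enthalpy Γ V * (1 - (V 1 ^ 2 + V 2 ^ 2) * soundSq Γ V));
      0, -V 1 * soundSq Γ V / (lorentz V ^ 2 * (1 - (V 1 ^ 2 + V 2 ^ 2) * soundSq Γ V)), 0,
        bigH Γ V / (V 0 * enthalpy Γ V * lorentz V ^ 2 *
          (1 - (V 1 ^ 2 + V 2 ^ 2) * soundSq Γ V));
      0, -V 2 * soundSq Γ V / (lorentz V ^ 2 * (1 - (V 1 ^ 2 + V 2 ^ 2) * soundSq Γ V)), 0,
        -V 1 * V 2 * (1 - soundSq Γ V) / (V 0 * enthalpy Γ V * lorentz V ^ 2 *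
          (1 - (V 1 ^ 2 + V 2 ^ 2) * soundSq Γ V));
      0, V 0 * enthalpy Γ V * soundSq Γ V / (1 - (V 1 ^ 2 + V 2 ^ 2) * soundSq Γ V), 0,
        -V 1 * soundSq Γ V / (lorentz V ^ 2 * (1 - (V 1 ^ 2 + V 2 ^ 2) * soundSq Γ V))]

/-- The component `C₄` of the source in primitive variables; `k` is the source vector of the
balance law `U_t + F₁(U)_x = k`. -/
def srcP (Γ : ℝ) (k V : State) : ℝ :=
  1 / (1 - (V 1 ^ 2 + V 2 ^ 2) * soundSq Γ V) *
    (k 3 * (Γ - 1 + (V 1 ^ 2 + V 2 ^ 2) * soundSq Γ V) - (Γ - 1) / lorentz V * k 0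
      - (soundSq Γ V + Γ - 1) * (V 1 * k 1 + V 2 * k 2))

/-- The component `C₂` of the source in primitive variables. -/
def srcU (Γ : ℝ) (k V : State) : ℝ :=
  1 / (V 0 * enthalpy Γ V * lorentz V ^ 2) * (k 1 - V 1 * k 3 - V 1 * srcP Γ k V)

/-- The component `C₃` of the source in primitive variables. -/
def srcV (Γ : ℝ) (k V : State) : ℝ :=
  1 / (V 0 * enthalpy Γ V * lorentz V ^ 2) * (k 2 - V 2 * k 3 - V 2 * srcP Γ k V)

/-- The component `C₁` of the source in primitive variables. -/
def srcRho (Γ : ℝ) (k V : State) : ℝ :=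
  k 0 / lorentz V - lorentz V ^ 2 * V 0 * (V 1 * srcU Γ k V + V 2 * srcV Γ k V)

/-- The source `C = (C₁, C₂, C₃, C₄)` in primitive variables. -/
def primSource (Γ : ℝ) (k V : State) : State :=
  ![srcRho Γ k V, srcU Γ k V, srcV Γ k V, srcP Γ k V]

/-! ### Shocks and the generalized Riemann problem -/

/-- `V` (left) and `Vb` (right) are joined by a right shock of speed `σ`: the Rankine-Hugoniot
conditions and the Lax conditions of the fourth characteristic family (`λ₂ = λ₃ = u`). -/
def IsRightShock (Γ σ : ℝ) (V Vb : State) : Prop :=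
  flux Γ V - flux Γ Vb = σ • (conserved Γ V - conserved Γ Vb) ∧
    V 1 < σ ∧ σ < lamFour Γ V ∧ lamFour Γ Vb < σ

/-- The open space-time region `0 < t < T`, `X t < x < Y t`; points are `(t, x)`. -/
def openRegion (T : ℝ) (X Y : ℝ → ℝ) : Set (ℝ × ℝ) :=
  {z | 0 < z.1 ∧ z.1 < T ∧ X z.1 < z.2 ∧ z.2 < Y z.1}

/-- The region `0 ≤ t < T`, `X t ≤ x ≤ Y t`, with its lateral boundary and the origin. -/
def closedRegion (T : ℝ) (X Y : ℝ → ℝ) : Set (ℝ × ℝ) :=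
  {z | 0 ≤ z.1 ∧ z.1 < T ∧ X z.1 ≤ z.2 ∧ z.2 ≤ Y z.1}

/-- The open region `0 < t < T`, `X t < x < R` on the right of a curve. -/
def openRight (T R : ℝ) (X : ℝ → ℝ) : Set (ℝ × ℝ) :=
  {z | 0 < z.1 ∧ z.1 < T ∧ X z.1 < z.2 ∧ z.2 < R}

/-- The region `0 ≤ t < T`, `X t ≤ x < R` on the right of a curve, with the curve and the initial
line. -/
def closedRight (T R : ℝ) (X : ℝ → ℝ) : Set (ℝ × ℝ) :=
  {z | 0 ≤ z.1 ∧ z.1 < T ∧ X z.1 ≤ z.2 ∧ z.2 < R}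

/-- The speed of a curve `x = X t`, `0 ≤ t < T` (one-sided at `t = 0`). -/
def curveSpeed (T : ℝ) (X : ℝ → ℝ) (t : ℝ) : ℝ := derivWithin X (Ico 0 T) t

/-- A smooth piece of the solution: `V` takes admissible values and is continuously differentiable
up to the boundary on `S`, and `U_t + F₁(U)_x = k` holds in the open part `O`. -/
def IsSmoothPiece (Γ : ℝ) (k : State) (S O : Set (ℝ × ℝ)) (V : ℝ × ℝ → State) : Prop :=
  ContDiffOn ℝ 1 V S ∧ (∀ z ∈ S, Admissible (V z)) ∧
    ∀ z ∈ O, fderiv ℝ (fun y => conserved Γ (V y)) z (1, 0) +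
      fderiv ℝ (fun y => flux Γ (V y)) z (0, 1) = k

/-- A local piecewise smooth solution of the quasi-1D generalized Riemann problem whose right wave
is a shock. The initial data on the right of the origin are `V₀`. The star region lies between
the trailing edge `x = Xl t` of the left wave (which may be of any kind) and the shock `x = Xs t`;
the contact discontinuity `x = Xc t` splits it into a left part, with solution `VL`, and a right
part, with solution `VR`. The solution ahead of the shock is `Vr`. -/
structure IsGRPSolutionRightShock (Γ : ℝ) (k : State) (V₀ : ℝ → State) (T R : ℝ)
    (Xl Xc Xs : ℝ → ℝ) (VL VR Vr : ℝ × ℝ → State) : Prop where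
  T_pos : 0 < T
  Xl_zero : Xl 0 = 0
  Xc_zero : Xc 0 = 0
  Xs_zero : Xs 0 = 0
  Xl_cont : ContinuousOn Xl (Ico 0 T)
  Xc_smooth : ContDiffOn ℝ 1 Xc (Ico 0 T)
  Xs_smooth : ContDiffOn ℝ 1 Xs (Ico 0 T)
  Xl_lt_Xc : ∀ t ∈ Ioo 0 T, Xl t < Xc t
  Xc_lt_Xs : ∀ t ∈ Ioo 0 T, Xc t < Xs t
  Xs_lt_R : ∀ t ∈ Ico 0 T, Xs t < R
  left_star : IsSmoothPiece Γ k (closedRegion T Xl Xc) (openRegion T Xl Xc) VL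
  right_star : IsSmoothPiece Γ k (closedRegion T Xc Xs) (openRegion T Xc Xs) VR
  right_outer : IsSmoothPiece Γ k (closedRight T R Xs) (openRight T R Xs) Vr
  initial : ∀ x ∈ Ico 0 R, Vr (0, x) = V₀ x
  contact_velocity : ∀ t ∈ Ico 0 T, VL (t, Xc t) 1 = VR (t, Xc t) 1
  contact_pressure : ∀ t ∈ Ico 0 T, VL (t, Xc t) 3 = VR (t, Xc t) 3
  contact_speed : ∀ t ∈ Ico 0 T, curveSpeed T Xc t = VR (t, Xc t) 1
  shock : ∀ t ∈ Ico 0 T, IsRightShock Γ (curveSpeed T Xs t) (VR (t, Xs t)) (Vr (t, Xs t))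

/-- The total derivative `D/Dt = ∂_t + u ∂_x` of the `i`-th primitive variable. -/
def materialDeriv (V : ℝ × ℝ → State) (i : Fin 4) (z : ℝ × ℝ) : ℝ :=
  fderiv ℝ (fun y => V y i) z (1, V z 1)

/-- The derivative `D/Ds = ∂_t + s ∂_x` along the shock of the state ahead of the shock, in terms of
its value `Vb` and its initial slope `Vb_x`. -/
def aheadDs (Γ : ℝ) (k : State) (s : ℝ) (Vb Vbx : State) : State :=
  primSource Γ k Vb + (s • Vbx - (primMatrix Γ Vb).mulVec Vbx)

/-! ### Coefficients of the differentiated shock relation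

Here `V` is the state behind and `Vb` the state ahead of the shock, `[q] = q(V) - q(Vb)`. For a
shock, the Rankine-Hugoniot conditions give the Taub adiabat
`h² - hb² = (h / ρ + hb / ρb) [p]`, the continuity of `h W v`, and
`[p] [1 / (ρ W)] + [u] [h W u] = 0`. Differentiating the last relation along the shock, and
eliminating `Dρ/Ds` by the first and `Dv/Ds` by the second, leaves
`A_u Du/Ds + A_p Dp/Ds = A_rhs`, with the coefficients below. -/

/-- `∂h/∂ρ` at fixed `p`. -/
def enthRho (Γ : ℝ) (V : State) : ℝ := -(Γ / (Γ - 1)) * V 3 / V 0 ^ 2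

/-- `∂h/∂p` at fixed `ρ`. -/
def enthP (Γ : ℝ) (V : State) : ℝ := Γ / (Γ - 1) / V 0

/-- The pressure jump `[p]`. -/
def jumpP (V Vb : State) : ℝ := V 3 - Vb 3

/-- The velocity jump `[u]`. -/
def jumpU (V Vb : State) : ℝ := V 1 - Vb 1

/-- The jump `[h W u]`. -/
def jumpM (Γ : ℝ) (V Vb : State) : ℝ :=
  enthalpy Γ V * lorentz V * V 1 - enthalpy Γ Vb * lorentz Vb * Vb 1

/-- The jump `[1 / (ρ W)]`. -/
def jumpTau (V Vb : State) : ℝ := 1 / (V 0 * lorentz V) - 1 / (Vb 0 * lorentz Vb)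

/-- Partial derivative of `h² - hb² - (h / ρ + hb / ρb) [p]` in `ρ`. -/
def taubRho (Γ : ℝ) (V Vb : State) : ℝ :=
  2 * enthalpy Γ V * enthRho Γ V -
    jumpP V Vb * (enthRho Γ V / V 0 - enthalpy Γ V / V 0 ^ 2)

/-- Partial derivative of `h² - hb² - (h / ρ + hb / ρb) [p]` in `p`. -/
def taubP (Γ : ℝ) (V Vb : State) : ℝ :=
  2 * enthalpy Γ V * enthP Γ V - (enthalpy Γ V / V 0 + enthalpy Γ Vb / Vb 0) -
    jumpP V Vb * (enthP Γ V / V 0)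

/-- Partial derivative of `h² - hb² - (h / ρ + hb / ρb) [p]` in `ρb`. -/
def taubRhoB (Γ : ℝ) (V Vb : State) : ℝ :=
  -(2 * enthalpy Γ Vb * enthRho Γ Vb) -
    jumpP V Vb * (enthRho Γ Vb / Vb 0 - enthalpy Γ Vb / Vb 0 ^ 2)

/-- Partial derivative of `h² - hb² - (h / ρ + hb / ρb) [p]` in `pb`. -/
def taubPB (Γ : ℝ) (V Vb : State) : ℝ :=
  -(2 * enthalpy Γ Vb * enthP Γ Vb) + (enthalpy Γ V / V 0 + enthalpy Γ Vb / Vb 0) -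
    jumpP V Vb * (enthP Γ Vb / Vb 0)

/-- Coefficient of `Dp/Ds` in `Dρ/Ds = rhoP Dp/Ds + rhoRhoB Dρb/Ds + rhoPB Dpb/Ds`, which holds
along the Taub adiabat. -/
def rhoP (Γ : ℝ) (V Vb : State) : ℝ := -(taubP Γ V Vb / taubRho Γ V Vb)

/-- Coefficient of `Dρb/Ds` in the same expression of `Dρ/Ds`. -/
def rhoRhoB (Γ : ℝ) (V Vb : State) : ℝ := -(taubRhoB Γ V Vb / taubRho Γ V Vb)

/-- Coefficient of `Dpb/Ds` in the same expression of `Dρ/Ds`. -/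
def rhoPB (Γ : ℝ) (V Vb : State) : ℝ := -(taubPB Γ V Vb / taubRho Γ V Vb)

/-- Partial derivative in `u` of the Lorentz factor, written with `Q = h W v` as
`W = ((1 + Q² / h²) / (1 - u²))^(1/2)`. -/
def lorU (V : State) : ℝ := V 1 * lorentz V / (1 - V 1 ^ 2)

/-- Partial derivative in `h` of the Lorentz factor as a function of `u`, `h` and `Q = h W v`. -/
def lorH (Γ : ℝ) (V : State) : ℝ :=
  -(lorentz V * V 2 ^ 2 / (enthalpy Γ V * (1 - V 1 ^ 2)))

/-- Partial derivative in `Q` of the Lorentz factor as a function of `u`, `h` and `Q = h W v`. -/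
def lorQ (Γ : ℝ) (V : State) : ℝ := V 2 / (enthalpy Γ V * (1 - V 1 ^ 2))

/-- Partial derivative of `[p] [1 / (ρ W)] + [u] [h W u]` in `W`. -/
def psiW (Γ : ℝ) (V Vb : State) : ℝ :=
  -(jumpP V Vb / (V 0 * lorentz V ^ 2)) + jumpU V Vb * enthalpy Γ V * V 1

/-- Derivative of `[p] [1 / (ρ W)] + [u] [h W u]` in `h`, with the dependence of `W` on `h`. -/
def psiH (Γ : ℝ) (V Vb : State) : ℝ :=
  jumpU V Vb * lorentz V * V 1 + psiW Γ V Vb * lorH Γ V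

/-- Derivative of `[p] [1 / (ρ W)] + [u] [h W u]` in `ρ`, with the dependence of `h` and `W` on
`ρ`. -/
def psiRho (Γ : ℝ) (V Vb : State) : ℝ :=
  -(jumpP V Vb / (V 0 ^ 2 * lorentz V)) + psiH Γ V Vb * enthRho Γ V

/-- Derivative of the relation in the Lorentz factor `Wb` ahead of the shock, with the dependence
of `W` on `Q = hb Wb vb`. -/
def psiWB (Γ : ℝ) (V Vb : State) : ℝ :=
  jumpP V Vb / (Vb 0 * lorentz Vb ^ 2) - jumpU V Vb * enthalpy Γ Vb * Vb 1 +
    psiW Γ V Vb * lorQ Γ V * enthalpy Γ Vb * Vb 2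

/-- Derivative of the relation in the enthalpy `hb` ahead of the shock, with the dependence of `W`
on `Q = hb Wb vb`. -/
def psiHB (Γ : ℝ) (V Vb : State) : ℝ :=
  -(jumpU V Vb * lorentz Vb * Vb 1) + psiW Γ V Vb * lorQ Γ V * lorentz Vb * Vb 2

/-- The coefficient `A_u`. -/
def coefAu (Γ : ℝ) (V Vb : State) : ℝ :=
  jumpM Γ V Vb + jumpU V Vb * enthalpy Γ V * lorentz V + psiW Γ V Vb * lorU V

/-- The coefficient `A_p`. -/
def coefAp (Γ : ℝ) (V Vb : State) : ℝ :=
  jumpTau V Vb + psiH Γ V Vb * enthP Γ V + psiRho Γ V Vb * rhoP Γ V Vb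

/-- The right-hand side `A_rhs`; `Y = (Dρb/Ds, Dub/Ds, Dvb/Ds, Dpb/Ds)` is the derivative along the
shock of the state ahead. -/
def coefArhs (Γ : ℝ) (V Vb Y : State) : ℝ :=
  -((jumpP V Vb / (Vb 0 ^ 2 * lorentz Vb) + psiRho Γ V Vb * rhoRhoB Γ V Vb +
        psiHB Γ V Vb * enthRho Γ Vb) * Y 0 +
    (-(jumpM Γ V Vb) - jumpU V Vb * enthalpy Γ Vb * lorentz Vb +
        psiWB Γ V Vb * (lorentz Vb ^ 3 * Vb 1)) * Y 1 +
    (psiW Γ V Vb * lorQ Γ V * enthalpy Γ Vb * lorentz Vb +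
        psiWB Γ V Vb * (lorentz Vb ^ 3 * Vb 2)) * Y 2 +
    (-(jumpTau V Vb) + psiRho Γ V Vb * rhoPB Γ V Vb + psiHB Γ V Vb * enthP Γ Vb) * Y 3)

/-! ### The coefficients of the linear relation -/

/-- `A_us = u C₂ + H / (ρ h c_s²) C₄`. -/
def coefAus (Γ : ℝ) (k V : State) : ℝ :=
  V 1 * srcU Γ k V + bigH Γ V / (V 0 * enthalpy Γ V * soundSq Γ V) * srcP Γ k V

/-- `A_ps = ρ h W² C₂ + u C₄`. -/
def coefAps (Γ : ℝ) (k V : State) : ℝ :=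
  V 0 * enthalpy Γ V * lorentz V ^ 2 * srcU Γ k V + V 1 * srcP Γ k V

/-- `a_R`, for given `A_u` and `A_p`. -/
def coefAR (Γ s : ℝ) (V : State) (Au Ap : ℝ) : ℝ :=
  Au + (V 1 - s) / (1 - V 1 * s) * (V 0 * enthalpy Γ V * lorentz V ^ 2) * Ap

/-- `b_R`, for given `A_u` and `A_p`. -/
def coefBR (Γ s : ℝ) (V : State) (Au Ap : ℝ) : ℝ :=
  Ap + (V 1 - s) / (1 - V 1 * s) * (bigH Γ V / (V 0 * enthalpy Γ V * soundSq Γ V)) * Au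

/-- `d_R`, for given `A_u`, `A_p` and `A_rhs`. -/
def coefDR (Γ s : ℝ) (k V : State) (Au Ap Arhs : ℝ) : ℝ :=
  (1 - V 1 ^ 2) / (1 - V 1 * s) * Arhs +
    (V 1 - s) / (1 - V 1 * s) * (coefAus Γ k V * Au + coefAps Γ k V * Ap)

/-- `Ψ (u, p, Vb)` is a shock relation near the shock from `V` to `Vb` of speed `s`: it vanishes on
all nearby right shocks, `u` and `p` being taken behind the shock and `Vb` ahead of it. -/
def IsShockRelation (Γ s : ℝ) (V Vb : State) (Ψ : ℝ × ℝ × State → ℝ) : Prop :=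
  ∀ᶠ q : State × State × ℝ in 𝓝 (V, Vb, s),
    IsRightShock Γ q.2.2 q.1 q.2.1 → Ψ (q.1 1, q.1 3, q.2.1) = 0

end RHD

end

noncomputable section

namespace RHD

section


variable {Γ s : ℝ} {k V Vb : State}

/-! ### Admissible states -/

/-! The solution is `C¹` up to the boundary in each region, so near the origin it is described to
first order by one linear map `L` per region. This `L` is both the derivative within the closed
region and the limit of the derivatives from the open region (`exists_hasFDerivWithinAt_tendsto`). A
curve through the origin with slope `r` therefore sees the derivative `L (1, r)` of the solution,
and every interface condition becomes a linear condition on `L`.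

Along the contact the slope is `u`, so `L (1, u)` is the limit of the material derivative. Since `u`
and `p` are continuous across the contact, their material derivatives agree on the two sides. Along
the shock the slope is `s`. Differentiating the consequences of the Rankine-Hugoniot conditions
(`IsRightShock.normal`, `IsRightShock.taub`, `IsRightShock.transverse`) and eliminating the
derivatives of `ρ` and `v` behind the shock gives one linear relation between `Du/Ds` and `Dp/Ds`
(`coefAu_mul_add_coefAp_mul`, `shock_deriv`). Its right-hand side is known: ahead of the shock `∂ₓ`
is the slope of the data and `∂ₜ` follows from the quasilinear form (`eq_primSource_sub`). For an
arbitrary relation `Ψ` the chain rule plays the same part (`shockRelation_deriv`).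

It remains to pass from `D/Ds` to `D/Dt`. The two differ by `(s - u) ∂ₓ`, and the balance law, which
survives in the limit at the origin (`IsSmoothPiece.balance`), expresses `(1 - u²) ∂ₓu` and `(1 -
u²) ∂ₓp` through the material derivatives and the source (`velocity_gradient`, `pressure_gradient`).
Substituting and dividing by `1 - u s` produces `a_R`, `b_R` and `d_R` (`material_relation`). This
division is legitimate because characteristic speeds are subluminal, and the elimination of `Dρ/Ds`
because `taubRho` is negative. -/

lemma Admissible.lorentz_pos (hV : Admissible V) : 0 < lorentz V := by
  have := hV.2.2
  unfold lorentz
  have : 0 < Real.sqrt (1 - (V 1 ^ 2 + V 2 ^ 2)) := Real.sqrt_pos.2 (by linarith)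
  positivity

lemma Admissible.lorentz_sq (hV : Admissible V) :
    lorentz V ^ 2 * (1 - V 1 ^ 2 - V 2 ^ 2) = 1 := by
  have h1 := hV.2.2
  unfold lorentz
  rw [div_pow, Real.sq_sqrt (by linarith)]
  have : 1 - (V 1 ^ 2 + V 2 ^ 2) ≠ 0 := by linarith
  field_simp
  ring

lemma enthalpy_eq (hΓ : 1 < Γ) (hV : Admissible V) :
    (Γ - 1) * V 0 * (enthalpy Γ V - 1) = Γ * V 3 := by
  have h0 := hV.1.ne'
  have h1 : Γ - 1 ≠ 0 := by linarith
  unfold enthalpy internalEnergy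
  field_simp
  ring

lemma one_lt_enthalpy (hΓ : 1 < Γ) (hV : Admissible V) : 1 < enthalpy Γ V := by
  have h := enthalpy_eq hΓ hV
  have h0 := hV.1
  have h3 := hV.2.1
  have h1 : 0 < Γ - 1 := by linarith
  have : 0 < (Γ - 1) * V 0 * (enthalpy Γ V - 1) := by rw [h]; positivity
  have := pos_of_mul_pos_right this (by positivity)
  linarith

lemma soundSq_mul (hΓ : 1 < Γ) (hV : Admissible V) :
    soundSq Γ V * (V 0 * enthalpy Γ V) = Γ * V 3 := by
  have h0 := hV.1.ne'
  have h1 : enthalpy Γ V ≠ 0 := by linarith [one_lt_enthalpy hΓ hV]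
  unfold soundSq
  field_simp

lemma soundSq_pos (hΓ : 1 < Γ) (hV : Admissible V) : 0 < soundSq Γ V := by
  have h0 := hV.1
  have h3 := hV.2.1
  have h1 : 0 < enthalpy Γ V := by linarith [one_lt_enthalpy hΓ hV]
  unfold soundSq
  positivity

/-- By the equation of state `Γ p = (Γ - 1) ρ (h - 1)`, which is below `ρ h` because `Γ - 1 ≤ 1`.
This is where the upper bound on `Γ` matters. -/
lemma soundSq_lt_one (hΓ : 1 < Γ) (hΓ' : Γ ≤ 2) (hV : Admissible V) : soundSq Γ V < 1 := by
  have h0 := hV.1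
  have h3 := hV.2.1
  have h1 := one_lt_enthalpy hΓ hV
  have h2 := enthalpy_eq hΓ hV
  unfold soundSq
  rw [div_lt_one (by positivity), ← h2]
  have : 0 < V 0 * (enthalpy Γ V - 1) := mul_pos h0 (by linarith)
  nlinarith

lemma acoustic_pos (hΓ : 1 < Γ) (hΓ' : Γ ≤ 2) (hV : Admissible V) :
    0 < 1 - (V 1 ^ 2 + V 2 ^ 2) * soundSq Γ V := by
  have := soundSq_lt_one hΓ hΓ' hV
  have := soundSq_pos hΓ hV
  have := hV.2.2
  nlinarith [sq_nonneg (V 1), sq_nonneg (V 2)]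

lemma bigH_pos (hΓ : 1 < Γ) (hΓ' : Γ ≤ 2) (hV : Admissible V) : 0 < bigH Γ V := by
  have := soundSq_lt_one hΓ hΓ' hV
  have := hV.2.2
  unfold bigH
  nlinarith [sq_nonneg (V 1), sq_nonneg (V 2)]

lemma Admissible.u_lt_one (hV : Admissible V) : V 1 < 1 := by
  have := hV.2.2
  nlinarith [sq_nonneg (V 1 - 1), sq_nonneg (V 2)]

lemma Admissible.neg_one_lt_u (hV : Admissible V) : -1 < V 1 := by
  have := hV.2.2
  nlinarith [sq_nonneg (V 1 + 1), sq_nonneg (V 2)]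

lemma Admissible.one_sub_u_sq_pos (hV : Admissible V) : 0 < 1 - V 1 ^ 2 := by
  nlinarith [hV.u_lt_one, hV.neg_one_lt_u]

/-- Causality: after clearing the positive denominator, the claim bounds a product of square roots
by a positive quantity, so squares may be compared. -/
lemma lamFour_lt_one (hΓ : 1 < Γ) (hΓ' : Γ ≤ 2) (hV : Admissible V) : lamFour Γ V < 1 := by
  have hc1 := soundSq_lt_one hΓ hΓ' hV
  have hc0 := soundSq_pos hΓ hV
  have hH := bigH_pos hΓ hΓ' hV
  have hu := hV.u_lt_one
  have hq := hV.2.2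
  have hW := hV.lorentz_pos
  have hW2 := hV.lorentz_sq
  unfold lamFour
  rw [div_lt_one (acoustic_pos hΓ hΓ' hV)]
  have hWi : (lorentz V)⁻¹ ^ 2 = 1 - V 1 ^ 2 - V 2 ^ 2 := by
    field_simp
    linarith
  set c := soundSq Γ V with hc
  set u := V 1
  set v := V 2
  set w := (lorentz V)⁻¹
  have key : Real.sqrt c * w * Real.sqrt (bigH Γ V) <
      (1 - c) * (1 - u) + c * (1 - (u ^ 2 + v ^ 2)) := by
    have h1 : 0 < (1 - c) * (1 - u) := mul_pos (by linarith) (by linarith)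
    have h2 : 0 < c * (1 - (u ^ 2 + v ^ 2)) := mul_pos hc0 (by linarith)
    apply lt_of_pow_lt_pow_left₀ 2 (by linarith)
    rw [mul_pow, mul_pow, Real.sq_sqrt hc0.le, Real.sq_sqrt hH.le, hWi]
    unfold bigH
    rw [← hc]
    -- This product is exactly the difference of the two squares; its last factor equals `1 - (u² +
    -- v²) c`.
    have h3 : 0 < (1 - c) * (1 - u) ^ 2 * ((1 - c) + c * (1 - (u ^ 2 + v ^ 2))) := by
      have : 0 < 1 - u := by linarith
      have : 0 < 1 - c := by linarith
      positivity
    linear_combination h3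
  linear_combination key

/-- The Lax conditions place `s` between `u > -1` and `λ₄ < 1`, so both `u` and `s` lie in `(-1,
1)`. -/
lemma IsRightShock.one_sub_mul_pos (hΓ : 1 < Γ) (hΓ' : Γ ≤ 2) (hV : Admissible V)
    (h : IsRightShock Γ s V Vb) : 0 < 1 - V 1 * s := by
  have h1 := lamFour_lt_one hΓ hΓ' hV
  have h2 := h.2.1
  have h3 := h.2.2.1
  have := hV.u_lt_one
  have := hV.neg_one_lt_u
  nlinarith

/-- With `G = Γ / (Γ - 1)` and `ρ h = ρ + G p`, multiplication by `ρ³` gives `-(2G - 1) ρ p - 2G (G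
- 1) p² - p_b (ρ + 2 G p)`, in which every term is negative whatever the sign of `[p]`. Hence the
Taub adiabat can be solved for the derivative of `ρ`. -/
lemma taubRho_neg (hΓ : 1 < Γ) (hΓ' : Γ ≤ 2) (hV : Admissible V) (hVb : Admissible Vb) :
    taubRho Γ V Vb < 0 := by
  have h0 := hV.1
  have h3 := hV.2.1
  have hb3 := hVb.2.1
  have hh := one_lt_enthalpy hΓ hV
  have he := enthalpy_eq hΓ hV
  have hΓ1 : 0 < Γ - 1 := by linarith
  set G := Γ / (Γ - 1) with hG
  have hG2 : 2 ≤ G := by rw [hG, le_div_iff₀ hΓ1]; linarith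
  have hhG : enthalpy Γ V * V 0 = V 0 + G * V 3 := by
    rw [hG]; field_simp; linarith
  have e : taubRho Γ V Vb * V 0 ^ 3 =
      -(2 * (V 0 + G * V 3) * G * V 3) + (V 3 - Vb 3) * (V 0 + 2 * G * V 3) := by
    unfold taubRho enthRho jumpP
    rw [← hG]
    field_simp
    linear_combination (-2 * G * V 3 + V 3 - Vb 3) * hhG
  have : taubRho Γ V Vb * V 0 ^ 3 < 0 := by
    rw [e]
    have : 0 < G := by linarith
    have h1 : 0 < Vb 3 * (V 0 + 2 * G * V 3) := by positivity
    have h2 : 0 < G * V 3 ^ 2 := by positivity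
    nlinarith [mul_pos h0 h3]
  exact neg_of_mul_neg_left this (by positivity)

end

section


variable {Γ s : ℝ} {k V Vb : State}

/-! ### Differentiation along curves of states -/

section Curves

variable {γ : ℝ → State} {Z : State} {S : Set ℝ} {t : ℝ}

lemma hasDerivWithinAt_lorentz (hV : Admissible (γ t)) (hγ : HasDerivWithinAt γ Z S t) :
    HasDerivWithinAt (fun r => lorentz (γ r))
      (lorentz (γ t) ^ 3 * (γ t 1 * Z 1 + γ t 2 * Z 2)) S t := by
  have h := hasDerivWithinAt_pi.1 hγ
  have hq : 1 - (γ t 1 ^ 2 + γ t 2 ^ 2) ≠ 0 := by linarith [hV.2.2]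
  have hs : Real.sqrt (1 - (γ t 1 ^ 2 + γ t 2 ^ 2)) ≠ 0 :=
    (Real.sqrt_pos.2 (by linarith [hV.2.2])).ne'
  have := ((((h 1).pow 2).add ((h 2).pow 2)).const_sub 1).sqrt hq
  have := (hasDerivWithinAt_const t S (1 : ℝ)).div this hs
  refine this.congr_deriv ?_
  unfold lorentz
  simp only [Pi.add_apply, Pi.pow_apply]
  field_simp
  norm_num

lemma hasDerivWithinAt_enthalpy (hΓ : 1 < Γ) (hV : Admissible (γ t))
    (hγ : HasDerivWithinAt γ Z S t) :
    HasDerivWithinAt (fun r => enthalpy Γ (γ r))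
      (enthRho Γ (γ t) * Z 0 + enthP Γ (γ t) * Z 3) S t := by
  have h := hasDerivWithinAt_pi.1 hγ
  have h0 := hV.1.ne'
  have h1 : Γ - 1 ≠ 0 := by linarith
  have h2 := ((h 3).div ((h 0).const_mul (Γ - 1)) (mul_ne_zero h1 h0)).const_add 1
  refine (h2.add ((h 3).div (h 0) h0)).congr_deriv ?_
  unfold enthRho enthP
  field_simp
  ring

end Curves

/-- The derivative of the Lorentz factor at `V` in the direction `Z`. -/
def dLorentz (V Z : State) : ℝ := lorentz V ^ 3 * (V 1 * Z 1 + V 2 * Z 2)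

/-- The derivative of the enthalpy at `V` in the direction `Z`. -/
def dEnthalpy (Γ : ℝ) (V Z : State) : ℝ := enthRho Γ V * Z 0 + enthP Γ V * Z 3

/-- The derivative of `ρ W` at `V` in the direction `Z`. -/
def dDensity (V Z : State) : ℝ := Z 0 * lorentz V + V 0 * dLorentz V Z

/-- The derivative of `ρ h W²` at `V` in the direction `Z`. -/
def dInertia (Γ : ℝ) (V Z : State) : ℝ :=
  (dDensity V Z * enthalpy Γ V + V 0 * lorentz V * dEnthalpy Γ V Z) * lorentz V +
    V 0 * lorentz V * enthalpy Γ V * dLorentz V Z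

/-- The derivative of the conserved vector at `V` in the direction `Z`. -/
def dConserved (Γ : ℝ) (V Z : State) : State :=
  ![dDensity V Z,
    dInertia Γ V Z * V 1 + V 0 * lorentz V * enthalpy Γ V * lorentz V * Z 1,
    dInertia Γ V Z * V 2 + V 0 * lorentz V * enthalpy Γ V * lorentz V * Z 2,
    dInertia Γ V Z - Z 3]

/-- The derivative of the flux at `V` in the direction `Z`. -/
def dFlux (Γ : ℝ) (V Z : State) : State :=
  ![dConserved Γ V Z 0 * V 1 + conserved Γ V 0 * Z 1,
    dConserved Γ V Z 1 * V 1 + conserved Γ V 1 * Z 1 + Z 3,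
    dConserved Γ V Z 2 * V 1 + conserved Γ V 2 * Z 1,
    dConserved Γ V Z 1]

section Curves

variable {γ : ℝ → State} {Z : State} {S : Set ℝ} {t : ℝ}

lemma hasDerivWithinAt_conserved (hΓ : 1 < Γ) (hV : Admissible (γ t))
    (hγ : HasDerivWithinAt γ Z S t) :
    HasDerivWithinAt (fun r => conserved Γ (γ r)) (dConserved Γ (γ t) Z) S t := by
  have h := hasDerivWithinAt_pi.1 hγ
  have hD := (h 0).mul (hasDerivWithinAt_lorentz hV hγ)
  have hI := (hD.mul (hasDerivWithinAt_enthalpy hΓ hV hγ)).mul (hasDerivWithinAt_lorentz hV hγ)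
  rw [hasDerivWithinAt_pi]
  intro i
  fin_cases i
  · exact hD
  · exact hI.mul (h 1)
  · exact hI.mul (h 2)
  · exact hI.sub (h 3)

lemma hasDerivWithinAt_flux (hΓ : 1 < Γ) (hV : Admissible (γ t))
    (hγ : HasDerivWithinAt γ Z S t) :
    HasDerivWithinAt (fun r => flux Γ (γ r)) (dFlux Γ (γ t) Z) S t := by
  have h := hasDerivWithinAt_pi.1 hγ
  have hU := hasDerivWithinAt_pi.1 (hasDerivWithinAt_conserved hΓ hV hγ)
  rw [hasDerivWithinAt_pi]
  intro i
  fin_cases i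
  · exact (hU 0).mul (h 1)
  · exact ((hU 1).mul (h 1)).add (h 3)
  · exact (hU 2).mul (h 1)
  · exact hU 1

end Curves

/-! ### Smoothness of the conserved vector and the flux -/

lemma contDiffAt_lorentz (hV : Admissible V) : ContDiffAt ℝ 1 lorentz V := by
  have hq : 1 - (V 1 ^ 2 + V 2 ^ 2) ≠ 0 := by linarith [hV.2.2]
  have hs : Real.sqrt (1 - (V 1 ^ 2 + V 2 ^ 2)) ≠ 0 :=
    (Real.sqrt_pos.2 (by linarith [hV.2.2])).ne'
  unfold lorentz
  exact contDiffAt_const.div (ContDiffAt.sqrt (by fun_prop) hq) hs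

lemma contDiffAt_enthalpy (hΓ : 1 < Γ) (hV : Admissible V) :
    ContDiffAt ℝ 1 (enthalpy Γ) V := by
  have h0 := hV.1.ne'
  have h1 : Γ - 1 ≠ 0 := by linarith
  unfold enthalpy internalEnergy
  have hρ : ContDiffAt ℝ 1 (fun V : State => V 0) V := by fun_prop
  have hp : ContDiffAt ℝ 1 (fun V : State => V 3) V := by fun_prop
  exact (contDiffAt_const.add (hp.div (contDiffAt_const.mul hρ) (mul_ne_zero h1 h0))).add
    (hp.div hρ h0)

lemma contDiffAt_conserved (hΓ : 1 < Γ) (hV : Admissible V) :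
    ContDiffAt ℝ 1 (conserved Γ) V := by
  have hW := contDiffAt_lorentz hV
  have hh := contDiffAt_enthalpy hΓ hV
  rw [contDiffAt_pi]
  intro i
  fin_cases i <;> simp [conserved] <;> fun_prop

lemma contDiffAt_flux (hΓ : 1 < Γ) (hV : Admissible V) : ContDiffAt ℝ 1 (flux Γ) V := by
  have hU := contDiffAt_pi.1 (contDiffAt_conserved hΓ hV)
  have h0 := hU 0
  have h1 := hU 1
  have h2 := hU 2
  rw [contDiffAt_pi]
  intro i
  fin_cases i <;> simp [flux] <;> fun_prop

lemma hasDerivWithinAt_line (V Z : State) :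
    HasDerivWithinAt (fun r : ℝ => V + r • Z) Z univ 0 := by
  simpa using (((hasDerivAt_id (0 : ℝ)).smul_const Z).const_add V).hasDerivWithinAt (s := univ)

/-- Testing along a line through `V` identifies the explicit directional formula with the Fréchet
derivative. The formula serves the algebra, the Fréchet derivative the passage to the limit. -/
lemma fderiv_conserved (hΓ : 1 < Γ) (hV : Admissible V) (Z : State) :
    fderiv ℝ (conserved Γ) V Z = dConserved Γ V Z := by
  have h1 := hasDerivWithinAt_conserved (γ := fun r : ℝ => V + r • Z) hΓ (t := 0) (by simpa)
    (hasDerivWithinAt_line V Z)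
  have h2 : HasFDerivAt (conserved Γ) (fderiv ℝ (conserved Γ) V) (V + (0 : ℝ) • Z) := by
    simpa using ((contDiffAt_conserved hΓ hV).differentiableAt one_ne_zero).hasFDerivAt
  have h3 := h2.comp_hasDerivAt (0 : ℝ) (hasDerivWithinAt_univ.1 (hasDerivWithinAt_line V Z))
  rw [hasDerivWithinAt_univ] at h1
  simpa using h3.unique h1

lemma fderiv_flux (hΓ : 1 < Γ) (hV : Admissible V) (Z : State) :
    fderiv ℝ (flux Γ) V Z = dFlux Γ V Z := by
  have h1 := hasDerivWithinAt_flux (γ := fun r : ℝ => V + r • Z) hΓ (t := 0) (by simpa)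
    (hasDerivWithinAt_line V Z)
  have h2 : HasFDerivAt (flux Γ) (fderiv ℝ (flux Γ) V) (V + (0 : ℝ) • Z) := by
    simpa using ((contDiffAt_flux hΓ hV).differentiableAt one_ne_zero).hasFDerivAt
  have h3 := h2.comp_hasDerivAt (0 : ℝ) (hasDerivWithinAt_univ.1 (hasDerivWithinAt_line V Z))
  rw [hasDerivWithinAt_univ] at h1
  simpa using h3.unique h1

/-! ### The balance law in primitive variables -/

section Primitive

variable {P Q : State}

lemma dEnthalpy_mul (hΓ : 1 < Γ) (hV : Admissible V) (Z : State) :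
    (Γ - 1) * (V 0 * dEnthalpy Γ V Z) = Γ * Z 3 - (Γ - 1) * (enthalpy Γ V - 1) * Z 0 := by
  have h := enthalpy_eq hΓ hV
  have h0 := hV.1.ne'
  have h1 : Γ - 1 ≠ 0 := by linarith
  unfold dEnthalpy enthRho enthP
  field_simp
  linear_combination Z 0 * h

/-- Conservation of mass. -/
lemma balance_mass (h : dConserved Γ V P + dFlux Γ V Q = k) :
    dDensity V P + V 1 * dDensity V Q + V 0 * lorentz V * Q 1 = k 0 := by
  have h0 := congrFun h 0
  simp [dConserved, dFlux, conserved] at h0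
  linear_combination h0

/-- The energy balance. -/
lemma balance_energy (h : dConserved Γ V P + dFlux Γ V Q = k) :
    dInertia Γ V P + V 1 * dInertia Γ V Q +
      V 0 * lorentz V ^ 2 * enthalpy Γ V * Q 1 - P 3 = k 3 := by
  have h0 := congrFun h 3
  simp [dConserved, dFlux, conserved] at h0
  linear_combination h0

/-- The equation of motion in the direction of `x`. -/
lemma balance_u (h : dConserved Γ V P + dFlux Γ V Q = k) :
    V 0 * enthalpy Γ V * lorentz V ^ 2 * (P 1 + V 1 * Q 1) =
      k 1 - V 1 * k 3 - V 1 * P 3 - Q 3 := by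
  have h0 := congrFun h 1
  simp [dConserved, dFlux, conserved] at h0
  linear_combination h0 - V 1 * balance_energy h

/-- The equation of motion in the transverse direction. -/
lemma balance_v (h : dConserved Γ V P + dFlux Γ V Q = k) :
    V 0 * enthalpy Γ V * lorentz V ^ 2 * (P 2 + V 1 * Q 2) =
      k 2 - V 2 * k 3 - V 2 * P 3 := by
  have h0 := congrFun h 2
  simp [dConserved, dFlux, conserved] at h0
  linear_combination h0 - V 2 * balance_energy h

/-- The pressure equation, without denominators. -/
lemma balance_p (hΓ : 1 < Γ) (hV : Admissible V) (h : dConserved Γ V P + dFlux Γ V Q = k) :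
    (1 - (V 1 ^ 2 + V 2 ^ 2) * soundSq Γ V) * P 3 + V 1 * (1 - soundSq Γ V) * Q 3 +
        V 0 * enthalpy Γ V * soundSq Γ V * Q 1 =
      k 3 * (Γ - 1 + (V 1 ^ 2 + V 2 ^ 2) * soundSq Γ V) - (Γ - 1) / lorentz V * k 0
        - (soundSq Γ V + Γ - 1) * (V 1 * k 1 + V 2 * k 2) := by
  have hm := balance_mass h
  have he := balance_energy h
  have hu := balance_u h
  have hv := balance_v h
  have hP := dEnthalpy_mul hΓ hV P
  have hQ := dEnthalpy_mul hΓ hV Q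
  have hh := enthalpy_eq hΓ hV
  have hc := soundSq_mul hΓ hV
  have hW := hV.lorentz_sq
  have hW0 := hV.lorentz_pos.ne'
  unfold dInertia at he
  unfold dDensity dLorentz at *
  set W := lorentz V
  set c := soundSq Γ V
  set e := enthalpy Γ V
  set S := V 1 * (P 1 + V 1 * Q 1) + V 2 * (P 2 + V 1 * Q 2) with hS
  -- Here `S` is velocity times acceleration, so the material derivative of `W` is `W³ S`. Mass
  -- balance and the equation of state eliminate the derivatives of `ρ` and `h` from the energy
  -- balance.
  have hB : W ^ 2 * Γ * (P 3 + V 1 * Q 3) + (Γ - 1) * (W * k 0 - P 3 - k 3) +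
      V 0 * e * (c + Γ - 1) * W ^ 4 * S + c * (V 0 * e) * W ^ 2 * Q 1 = 0 := by
    rw [hS]
    linear_combination (Γ - 1) * he - W ^ 2 * hP - W ^ 2 * V 1 * hQ - (Γ - 1) * W * hm +
      (W ^ 4 * S + W ^ 2 * Q 1) * (hc - hh)
  -- The equations of motion paired with the velocity, using `W² (u² + v²) = W² - 1`; this removes
  -- the acceleration from `hB`.
  have hC : V 0 * e * W ^ 4 * S = W ^ 2 * (V 1 * k 1 + V 2 * k 2) - (W ^ 2 - 1) * (k 3 + P 3) -
      W ^ 2 * V 1 * Q 3 := by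
    rw [hS]
    linear_combination W ^ 2 * V 1 * hu + W ^ 2 * V 2 * hv + (k 3 + P 3) * hW
  have hr : (Γ - 1) / W * W = Γ - 1 := div_mul_cancel₀ _ hW0
  apply mul_left_cancel₀ (pow_ne_zero 2 hW0)
  linear_combination hB - (c + Γ - 1) * hC + (c * P 3 + k 3 * c) * hW + W * k 0 * hr

end Primitive

end

/-! ### Quasilinear form, and gradients in terms of material derivatives -/

section


variable {Γ s : ℝ} {k V Vb P Q : State}

/-- The right-hand side of `balance_p` is `srcP` times its own denominator, so `srcP` can absorb the
source vector. -/
lemma srcP_mul (hΓ : 1 < Γ) (hΓ' : Γ ≤ 2) (hV : Admissible V)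
    (h : dConserved Γ V P + dFlux Γ V Q = k) :
    (1 - (V 1 ^ 2 + V 2 ^ 2) * soundSq Γ V) * (P 3 - srcP Γ k V) +
      V 1 * (1 - soundSq Γ V) * Q 3 + V 0 * enthalpy Γ V * soundSq Γ V * Q 1 = 0 := by
  have hp := balance_p hΓ hV h
  have hN := (acoustic_pos hΓ hΓ' hV).ne'
  unfold srcP
  rw [mul_sub, mul_comm (1 / _), ← mul_assoc, mul_one_div, ← hp]
  field_simp
  ring

lemma inertia_pos (hΓ : 1 < Γ) (hV : Admissible V) :
    0 < V 0 * enthalpy Γ V * lorentz V ^ 2 := by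
  have := hV.1
  have := one_lt_enthalpy hΓ hV
  have := hV.lorentz_pos
  positivity

lemma srcU_mul (hΓ : 1 < Γ) (hV : Admissible V) :
    V 0 * enthalpy Γ V * lorentz V ^ 2 * srcU Γ k V =
      k 1 - V 1 * k 3 - V 1 * srcP Γ k V := by
  have := (inertia_pos hΓ hV).ne'
  unfold srcU
  rw [← mul_assoc, mul_one_div_cancel this, one_mul]

lemma srcV_mul (hΓ : 1 < Γ) (hV : Admissible V) :
    V 0 * enthalpy Γ V * lorentz V ^ 2 * srcV Γ k V =
      k 2 - V 2 * k 3 - V 2 * srcP Γ k V := by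
  have := (inertia_pos hΓ hV).ne'
  unfold srcV
  rw [← mul_assoc, mul_one_div_cancel this, one_mul]

/-- The balance law implies the quasilinear form `V_t + A(V) V_x = C`. -/
lemma eq_primSource_sub (hΓ : 1 < Γ) (hΓ' : Γ ≤ 2) (hV : Admissible V)
    (h : dConserved Γ V P + dFlux Γ V Q = k) :
    P = primSource Γ k V - (primMatrix Γ V).mulVec Q := by
  have hm := balance_mass h
  have hu := balance_u h
  have hv := balance_v h
  have hp := srcP_mul hΓ hΓ' hV h
  have hCu := srcU_mul (k := k) hΓ hV
  have hCv := srcV_mul (k := k) hΓ hV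
  have hI := (inertia_pos hΓ hV).ne'
  have hN := (acoustic_pos hΓ hΓ' hV).ne'
  have hW := hV.lorentz_sq
  have hW0 := hV.lorentz_pos.ne'
  have h0 := hV.1.ne'
  have he : enthalpy Γ V ≠ 0 := by linarith [one_lt_enthalpy hΓ hV]
  unfold dDensity dLorentz at hm
  ext i
  fin_cases i <;>
    simp [primSource, primMatrix, Matrix.mulVec, dotProduct, Fin.sum_univ_four,
      Matrix.one_apply, srcRho, bigH]
  all_goals
    set W := lorentz V
    set c := soundSq Γ V
    set e := enthalpy Γ V
    set C1 := srcU Γ k V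
    set C2 := srcV Γ k V
    set C3 := srcP Γ k V
    -- The acoustic denominator becomes an atom for `field_simp`, its value remaining available
    -- through `hNd`.
    obtain ⟨N, hNd⟩ : ∃ N, N = 1 - (V 1 ^ 2 + V 2 ^ 2) * c := ⟨_, rfl⟩
    rw [← hNd] at hN hp ⊢
    -- `r1` and `r2` are the equations of motion multiplied by `N`, with the time derivative of `p`
    -- eliminated by `hp`.
    have r1 : N * (V 0 * e * W ^ 2 * (P 1 + V 1 * Q 1 - C1)) +
        (1 - V 1 ^ 2 - V 2 ^ 2 * c) * Q 3 - V 1 * (V 0 * e * c * Q 1) = 0 := by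
      linear_combination N * (hu - hCu) - V 1 * hp - Q 3 * hNd
    have r2 : N * (V 0 * e * W ^ 2 * (P 2 + V 1 * Q 2 - C2)) -
        V 1 * V 2 * (1 - c) * Q 3 - V 2 * (V 0 * e * c * Q 1) = 0 := by
      linear_combination N * (hv - hCv) - V 2 * hp
  · field_simp
    linear_combination W * N * e * hm - W ^ 2 * (V 1 * r1 + V 2 * r2) -
      W ^ 2 * V 0 * e * Q 1 * hNd + V 1 * Q 3 * hW
  · field_simp
    linear_combination r1
  · field_simp
    linear_combination r2
  · field_simp
    linear_combination W ^ 2 * hp + V 1 * c * Q 3 * hW + W ^ 2 * V 1 * Q 3 * hNd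

/-- The velocity gradient in terms of the material derivatives of `u` and `p`. -/
lemma velocity_gradient (hΓ : 1 < Γ) (hΓ' : Γ ≤ 2) (hV : Admissible V)
    (h : dConserved Γ V P + dFlux Γ V Q = k) :
    (1 - V 1 ^ 2) * Q 1 = coefAus Γ k V - V 1 * (P 1 + V 1 * Q 1) -
      bigH Γ V / (V 0 * enthalpy Γ V * soundSq Γ V) * (P 3 + V 1 * Q 3) := by
  have hu := balance_u h
  have hp := srcP_mul hΓ hΓ' hV h
  have hCu := srcU_mul (k := k) hΓ hV
  have hW := hV.lorentz_sq
  have hc := (soundSq_pos hΓ hV).ne'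
  have h0 := hV.1.ne'
  have he : enthalpy Γ V ≠ 0 := by linarith [one_lt_enthalpy hΓ hV]
  unfold coefAus
  set W := lorentz V
  set c := soundSq Γ V
  set e := enthalpy Γ V
  set C1 := srcU Γ k V
  set C3 := srcP Γ k V
  have hm : bigH Γ V / (V 0 * e * c) * (V 0 * e * c) = bigH Γ V :=
    div_mul_cancel₀ _ (mul_ne_zero (mul_ne_zero h0 he) hc)
  unfold bigH at hm ⊢
  set m := (1 - V 1 ^ 2 - V 2 ^ 2 * soundSq Γ V) / (V 0 * e * c)
  apply mul_left_cancel₀ (mul_ne_zero (mul_ne_zero h0 he) hc)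
  linear_combination (1 - V 1 ^ 2) * hp + V 1 * c * (1 - V 1 ^ 2 - V 2 ^ 2) * (hu - hCu) -
    V 0 * e * V 1 * c * (P 1 + V 1 * Q 1 - C1) * hW + (P 3 + V 1 * Q 3 - C3) * hm

/-- The pressure gradient in terms of the material derivatives of `u` and `p`. -/
lemma pressure_gradient (hΓ : 1 < Γ) (hV : Admissible V)
    (h : dConserved Γ V P + dFlux Γ V Q = k) :
    (1 - V 1 ^ 2) * Q 3 = coefAps Γ k V -
      V 0 * enthalpy Γ V * lorentz V ^ 2 * (P 1 + V 1 * Q 1) - V 1 * (P 3 + V 1 * Q 3) := by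
  have hu := balance_u h
  have hCu := srcU_mul (k := k) hΓ hV
  unfold coefAps
  linear_combination hu - hCu

/-- A linear relation between the derivatives of `u` and `p` along the shock gives one between their
material derivatives. -/
lemma material_relation {Au Ap Arhs : ℝ} (hΓ : 1 < Γ) (hΓ' : Γ ≤ 2) (hV : Admissible V)
    (hs : 1 - V 1 * s ≠ 0) (h : dConserved Γ V P + dFlux Γ V Q = k)
    (hrel : Au * (P 1 + s * Q 1) + Ap * (P 3 + s * Q 3) = Arhs) :
    coefAR Γ s V Au Ap * (P 1 + V 1 * Q 1) + coefBR Γ s V Au Ap * (P 3 + V 1 * Q 3) =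
      coefDR Γ s k V Au Ap Arhs := by
  have hu := velocity_gradient hΓ hΓ' hV h
  have hp := pressure_gradient hΓ hV h
  unfold coefAR coefBR coefDR
  generalize coefAus Γ k V = Aus at *
  generalize coefAps Γ k V = Aps at *
  generalize bigH Γ V / (V 0 * enthalpy Γ V * soundSq Γ V) = m at *
  generalize V 0 * enthalpy Γ V * lorentz V ^ 2 = I at *
  field_simp
  -- Both derivatives split as `D/Ds = D/Dt + (s - u) ∂ₓ`. The factor `1 - u s` arises as `(1 - u²)
  -- - (s - u) u`.
  linear_combination (1 - V 1 ^ 2) * hrel - (s - V 1) * Au * hu - (s - V 1) * Ap * hp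

end

section


variable {Γ s σ : ℝ} {k V Vb P Q : State}

/-! ### Relations across a shock -/

/-- The mass flux through a shock does not vanish, and the Rankine-Hugoniot conditions in terms of
it. -/
lemma IsRightShock.exists_massFlux (hV : Admissible V) (h : IsRightShock Γ σ V Vb) :
    ∃ j : ℝ, 0 < j ∧ V 0 * lorentz V * (σ - V 1) = j ∧ Vb 0 * lorentz Vb * (σ - Vb 1) = j ∧
      j * jumpM Γ V Vb = jumpP V Vb ∧
      j * (enthalpy Γ V * lorentz V * V 2 - enthalpy Γ Vb * lorentz Vb * Vb 2) = 0 ∧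
      j * (enthalpy Γ V * lorentz V - enthalpy Γ Vb * lorentz Vb) = σ * jumpP V Vb := by
  have h0 := congrFun h.1 0
  have h1 := congrFun h.1 1
  have h2 := congrFun h.1 2
  have h3 := congrFun h.1 3
  simp [flux, conserved] at h0 h1 h2 h3
  have hj : Vb 0 * lorentz Vb * (σ - Vb 1) = V 0 * lorentz V * (σ - V 1) := by
    linear_combination h0
  refine ⟨V 0 * lorentz V * (σ - V 1), ?_, rfl, hj, ?_, ?_, ?_⟩
  · have := hV.1
    have := hV.lorentz_pos
    have : 0 < σ - V 1 := by linarith [h.2.1]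
    positivity
  · unfold jumpM jumpP
    linear_combination -h1 + enthalpy Γ Vb * lorentz Vb * Vb 1 * hj
  · linear_combination -h2 + enthalpy Γ Vb * lorentz Vb * Vb 2 * hj
  · unfold jumpP
    linear_combination -h3 + enthalpy Γ Vb * lorentz Vb * hj

lemma IsRightShock.transverse (hV : Admissible V) (h : IsRightShock Γ σ V Vb) :
    enthalpy Γ V * lorentz V * V 2 - enthalpy Γ Vb * lorentz Vb * Vb 2 = 0 := by
  obtain ⟨j, hj, -, -, -, h2, -⟩ := h.exists_massFlux hV
  exact (mul_eq_zero.1 h2).resolve_left hj.ne'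

/-- Mass conservation reads `j [1 / (ρ W)] = -[u]` and momentum reads `j [h W u] = [p]`; eliminating
the nonzero mass flux `j` removes the shock speed. -/
lemma IsRightShock.normal (hV : Admissible V) (hVb : Admissible Vb)
    (h : IsRightShock Γ σ V Vb) :
    jumpP V Vb * jumpTau V Vb + jumpU V Vb * jumpM Γ V Vb = 0 := by
  obtain ⟨j, hj, hl, hr, h1, -, -⟩ := h.exists_massFlux hV
  have hD := (mul_pos hV.1 hV.lorentz_pos).ne'
  have hDb := (mul_pos hVb.1 hVb.lorentz_pos).ne'
  have ht : j * jumpTau V Vb = -jumpU V Vb := by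
    have h1 : j * (1 / (V 0 * lorentz V)) = σ - V 1 := by
      rw [mul_one_div, div_eq_iff hD, ← hl, mul_comm]
    have h2 : j * (1 / (Vb 0 * lorentz Vb)) = σ - Vb 1 := by
      rw [mul_one_div, div_eq_iff hDb, ← hr, mul_comm]
    unfold jumpTau jumpU
    linear_combination h1 - h2
  apply mul_left_cancel₀ hj.ne'
  linear_combination jumpP V Vb * ht + jumpU V Vb * h1

/-- The Taub adiabat. -/
lemma IsRightShock.taub (hV : Admissible V) (hVb : Admissible Vb)
    (h : IsRightShock Γ σ V Vb) :
    enthalpy Γ V ^ 2 - enthalpy Γ Vb ^ 2 -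
      (enthalpy Γ V / V 0 + enthalpy Γ Vb / Vb 0) * jumpP V Vb = 0 := by
  obtain ⟨j, hj, hl, hr, h1, -, h3⟩ := h.exists_massFlux hV
  have h2 := h.transverse hV
  have h0 := hV.1.ne'
  have hb0 := hVb.1.ne'
  have hW := hV.lorentz_sq
  have hWb := hVb.lorentz_sq
  -- Energy and momentum together give `[h W] = σ [h W u]`. The adiabat then follows from `h² = (h
  -- W)² - (h W u)² - (h W v)²`, the continuity of `h W v`, and `[p] h / ρ = [h W u] h W (σ - u)`
  -- with its counterpart ahead of the shock.
  have h4 : enthalpy Γ V * lorentz V - enthalpy Γ Vb * lorentz Vb = σ * jumpM Γ V Vb := by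
    apply mul_left_cancel₀ hj.ne'
    linear_combination h3 - σ * h1
  have hl' : jumpP V Vb * (enthalpy Γ V / V 0) =
      jumpM Γ V Vb * (enthalpy Γ V * lorentz V * (σ - V 1)) := by
    rw [← h1, ← hl]
    field_simp
  have hr' : jumpP V Vb * (enthalpy Γ Vb / Vb 0) =
      jumpM Γ V Vb * (enthalpy Γ Vb * lorentz Vb * (σ - Vb 1)) := by
    rw [← h1, ← hr]
    field_simp
  unfold jumpM at h4 hl' hr'
  linear_combination -enthalpy Γ V ^ 2 * hW + enthalpy Γ Vb ^ 2 * hWb - hl' - hr' +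
    (enthalpy Γ V * lorentz V + enthalpy Γ Vb * lorentz Vb) * h4 -
    (enthalpy Γ V * lorentz V * V 2 + enthalpy Γ Vb * lorentz Vb * Vb 2) * h2

/-! ### Differentiation along the shock -/

section Curves

variable {γ β : ℝ → State} {Z Y : State} {S : Set ℝ} {t : ℝ}

lemma HasDerivWithinAt.eq_zero_of_eqOn {f : ℝ → ℝ} {f' : ℝ} (hS : UniqueDiffWithinAt ℝ S t)
    (ht : t ∈ S) (hf : HasDerivWithinAt f f' S t) (h : ∀ r ∈ S, f r = 0) : f' = 0 :=
  hS.eq_deriv S hf ((hasDerivWithinAt_const t S (0 : ℝ)).congr h (h t ht))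

lemma deriv_taub (hΓ : 1 < Γ) (hV : Admissible (γ t)) (hVb : Admissible (β t))
    (hγ : HasDerivWithinAt γ Z S t) (hβ : HasDerivWithinAt β Y S t)
    (hS : UniqueDiffWithinAt ℝ S t) (ht : t ∈ S)
    (h : ∀ r ∈ S, enthalpy Γ (γ r) ^ 2 - enthalpy Γ (β r) ^ 2 -
      (enthalpy Γ (γ r) / γ r 0 + enthalpy Γ (β r) / β r 0) * jumpP (γ r) (β r) = 0) :
    taubRho Γ (γ t) (β t) * Z 0 + taubP Γ (γ t) (β t) * Z 3 + taubRhoB Γ (γ t) (β t) * Y 0 +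
      taubPB Γ (γ t) (β t) * Y 3 = 0 := by
  have hz := hasDerivWithinAt_pi.1 hγ
  have hy := hasDerivWithinAt_pi.1 hβ
  have he := hasDerivWithinAt_enthalpy hΓ hV hγ
  have heb := hasDerivWithinAt_enthalpy hΓ hVb hβ
  have h0 := hV.1.ne'
  have hb0 := hVb.1.ne'
  have key := HasDerivWithinAt.eq_zero_of_eqOn hS ht (((he.pow 2).sub (heb.pow 2)).sub
    (((he.div (hz 0) h0).add (heb.div (hy 0) hb0)).mul ((hz 3).sub (hy 3)))) h
  rw [← key]
  simp only [Pi.add_apply, Pi.sub_apply, Pi.div_apply]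
  unfold taubRho taubP taubRhoB taubPB jumpP
  field_simp
  push_cast
  ring

lemma deriv_transverse (hΓ : 1 < Γ) (hV : Admissible (γ t)) (hVb : Admissible (β t))
    (hγ : HasDerivWithinAt γ Z S t) (hβ : HasDerivWithinAt β Y S t)
    (hS : UniqueDiffWithinAt ℝ S t) (ht : t ∈ S)
    (h : ∀ r ∈ S, enthalpy Γ (γ r) * lorentz (γ r) * γ r 2 -
      enthalpy Γ (β r) * lorentz (β r) * β r 2 = 0) :
    dEnthalpy Γ (γ t) Z * lorentz (γ t) * γ t 2 + enthalpy Γ (γ t) * dLorentz (γ t) Z * γ t 2 +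
        enthalpy Γ (γ t) * lorentz (γ t) * Z 2 =
      dEnthalpy Γ (β t) Y * lorentz (β t) * β t 2 + enthalpy Γ (β t) * dLorentz (β t) Y * β t 2 +
        enthalpy Γ (β t) * lorentz (β t) * Y 2 := by
  have hz := hasDerivWithinAt_pi.1 hγ
  have hy := hasDerivWithinAt_pi.1 hβ
  have he := hasDerivWithinAt_enthalpy hΓ hV hγ
  have heb := hasDerivWithinAt_enthalpy hΓ hVb hβ
  have hw := hasDerivWithinAt_lorentz hV hγ
  have hwb := hasDerivWithinAt_lorentz hVb hβ
  have key := HasDerivWithinAt.eq_zero_of_eqOn hS ht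
    (((he.mul hw).mul (hz 2)).sub ((heb.mul hwb).mul (hy 2))) h
  simp only [Pi.mul_apply] at key
  unfold dEnthalpy dLorentz
  linear_combination key

lemma deriv_normal (hΓ : 1 < Γ) (hV : Admissible (γ t)) (hVb : Admissible (β t))
    (hγ : HasDerivWithinAt γ Z S t) (hβ : HasDerivWithinAt β Y S t)
    (hS : UniqueDiffWithinAt ℝ S t) (ht : t ∈ S)
    (h : ∀ r ∈ S, jumpP (γ r) (β r) * jumpTau (γ r) (β r) +
      jumpU (γ r) (β r) * jumpM Γ (γ r) (β r) = 0) :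
    (Z 3 - Y 3) * jumpTau (γ t) (β t) +
      jumpP (γ t) (β t) * (-(dDensity (γ t) Z / (γ t 0 * lorentz (γ t)) ^ 2) +
        dDensity (β t) Y / (β t 0 * lorentz (β t)) ^ 2) +
      (Z 1 - Y 1) * jumpM Γ (γ t) (β t) +
      jumpU (γ t) (β t) * (dEnthalpy Γ (γ t) Z * lorentz (γ t) * γ t 1 +
          enthalpy Γ (γ t) * dLorentz (γ t) Z * γ t 1 +
          enthalpy Γ (γ t) * lorentz (γ t) * Z 1 -
        (dEnthalpy Γ (β t) Y * lorentz (β t) * β t 1 +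
          enthalpy Γ (β t) * dLorentz (β t) Y * β t 1 +
          enthalpy Γ (β t) * lorentz (β t) * Y 1)) = 0 := by
  have hz := hasDerivWithinAt_pi.1 hγ
  have hy := hasDerivWithinAt_pi.1 hβ
  have he := hasDerivWithinAt_enthalpy hΓ hV hγ
  have heb := hasDerivWithinAt_enthalpy hΓ hVb hβ
  have hw := hasDerivWithinAt_lorentz hV hγ
  have hwb := hasDerivWithinAt_lorentz hVb hβ
  have hD := (mul_pos hV.1 hV.lorentz_pos).ne'
  have hDb := (mul_pos hVb.1 hVb.lorentz_pos).ne'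
  have h1 := (hasDerivWithinAt_const t S (1 : ℝ)).div ((hz 0).mul hw) hD
  have h2 := (hasDerivWithinAt_const t S (1 : ℝ)).div ((hy 0).mul hwb) hDb
  have key := HasDerivWithinAt.eq_zero_of_eqOn hS ht
    ((((hz 3).sub (hy 3)).mul (h1.sub h2)).add (((hz 1).sub (hy 1)).mul
      (((he.mul hw).mul (hz 1)).sub ((heb.mul hwb).mul (hy 1))))) h
  simp only [Pi.mul_apply, Pi.sub_apply, Pi.div_apply] at key
  rw [← key]
  unfold jumpP jumpTau jumpU jumpM dEnthalpy dDensity dLorentz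
  ring

end Curves

/-- This differentiates `W² (1 - u²) = 1 + Q² / h²` with `Q = h W v`. Since `Q` is continuous across
the shock, `q` can be computed ahead of it, and the derivative of `v` behind drops out. -/
lemma dLorentz_eq {Γ : ℝ} {Z : State} {q : ℝ} (hV : Admissible V) (he : enthalpy Γ V ≠ 0)
    (hq : dEnthalpy Γ V Z * lorentz V * V 2 + enthalpy Γ V * dLorentz V Z * V 2 +
      enthalpy Γ V * lorentz V * Z 2 = q) :
    dLorentz V Z = lorU V * Z 1 + lorH Γ V * dEnthalpy Γ V Z + lorQ Γ V * q := by
  have hW := hV.lorentz_sq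
  have hu := hV.one_sub_u_sq_pos.ne'
  have hd : dLorentz V Z = lorentz V ^ 3 * (V 1 * Z 1 + V 2 * Z 2) := rfl
  have hd' : dLorentz V Z * (1 - V 1 ^ 2 - V 2 ^ 2) = lorentz V * (V 1 * Z 1 + V 2 * Z 2) := by
    rw [hd]
    linear_combination lorentz V * (V 1 * Z 1 + V 2 * Z 2) * hW
  unfold lorU lorH lorQ
  rw [← hq]
  field_simp
  linear_combination enthalpy Γ V * hd'

/-- The differentiated shock relation, solved for the derivatives of `u` and `p`. -/
lemma coefAu_mul_add_coefAp_mul {Z Y : State} (hΓ : 1 < Γ) (hΓ' : Γ ≤ 2) (hV : Admissible V)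
    (hVb : Admissible Vb)
    (ht : taubRho Γ V Vb * Z 0 + taubP Γ V Vb * Z 3 + taubRhoB Γ V Vb * Y 0 +
      taubPB Γ V Vb * Y 3 = 0)
    (hq : dEnthalpy Γ V Z * lorentz V * V 2 + enthalpy Γ V * dLorentz V Z * V 2 +
        enthalpy Γ V * lorentz V * Z 2 =
      dEnthalpy Γ Vb Y * lorentz Vb * Vb 2 + enthalpy Γ Vb * dLorentz Vb Y * Vb 2 +
        enthalpy Γ Vb * lorentz Vb * Y 2)
    (hn : (Z 3 - Y 3) * jumpTau V Vb +
      jumpP V Vb * (-(dDensity V Z / (V 0 * lorentz V) ^ 2) +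
        dDensity Vb Y / (Vb 0 * lorentz Vb) ^ 2) +
      (Z 1 - Y 1) * jumpM Γ V Vb +
      jumpU V Vb * (dEnthalpy Γ V Z * lorentz V * V 1 +
          enthalpy Γ V * dLorentz V Z * V 1 + enthalpy Γ V * lorentz V * Z 1 -
        (dEnthalpy Γ Vb Y * lorentz Vb * Vb 1 +
          enthalpy Γ Vb * dLorentz Vb Y * Vb 1 + enthalpy Γ Vb * lorentz Vb * Y 1)) = 0) :
    coefAu Γ V Vb * Z 1 + coefAp Γ V Vb * Z 3 = coefArhs Γ V Vb Y := by
  have he : enthalpy Γ V ≠ 0 := by linarith [one_lt_enthalpy hΓ hV]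
  have hT := (taubRho_neg hΓ hΓ' hV hVb).ne
  have hZ0 : Z 0 = rhoP Γ V Vb * Z 3 + rhoRhoB Γ V Vb * Y 0 + rhoPB Γ V Vb * Y 3 := by
    unfold rhoP rhoRhoB rhoPB
    field_simp
    linear_combination ht
  have hW := dLorentz_eq hV he hq
  have hD : dDensity V Z / (V 0 * lorentz V) ^ 2 =
      Z 0 / (V 0 ^ 2 * lorentz V) + dLorentz V Z / (V 0 * lorentz V ^ 2) := by
    have := hV.1.ne'
    have := hV.lorentz_pos.ne'
    unfold dDensity
    field_simp
  have hDb : dDensity Vb Y / (Vb 0 * lorentz Vb) ^ 2 =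
      Y 0 / (Vb 0 ^ 2 * lorentz Vb) + dLorentz Vb Y / (Vb 0 * lorentz Vb ^ 2) := by
    have := hVb.1.ne'
    have := hVb.lorentz_pos.ne'
    unfold dDensity
    field_simp
  rw [hD, hDb] at hn
  have hh : dEnthalpy Γ V Z = enthRho Γ V * Z 0 + enthP Γ V * Z 3 := rfl
  have hhb : dEnthalpy Γ Vb Y = enthRho Γ Vb * Y 0 + enthP Γ Vb * Y 3 := rfl
  have hWb : dLorentz Vb Y = lorentz Vb ^ 3 * (Vb 1 * Y 1 + Vb 2 * Y 2) := rfl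
  have e1 : psiW Γ V Vb = -(jumpP V Vb / (V 0 * lorentz V ^ 2)) +
    jumpU V Vb * enthalpy Γ V * V 1 := rfl
  have e2 : psiH Γ V Vb = jumpU V Vb * lorentz V * V 1 + psiW Γ V Vb * lorH Γ V := rfl
  have e3 : psiRho Γ V Vb = -(jumpP V Vb / (V 0 ^ 2 * lorentz V)) +
    psiH Γ V Vb * enthRho Γ V := rfl
  have e4 : psiWB Γ V Vb = jumpP V Vb / (Vb 0 * lorentz Vb ^ 2) -
    jumpU V Vb * enthalpy Γ Vb * Vb 1 + psiW Γ V Vb * lorQ Γ V * enthalpy Γ Vb * Vb 2 := rfl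
  have e5 : psiHB Γ V Vb = -(jumpU V Vb * lorentz Vb * Vb 1) +
    psiW Γ V Vb * lorQ Γ V * lorentz Vb * Vb 2 := rfl
  unfold coefAu coefAp coefArhs
  -- The terms containing the derivative of `W` behind the shock are collected into `psiW`; `n2`
  -- then inserts `dLorentz_eq`, and only the derivative of `ρ` is left to eliminate.
  have n1 : (Z 3 - Y 3) * jumpTau V Vb + (Z 1 - Y 1) * jumpM Γ V Vb +
      psiW Γ V Vb * dLorentz V Z - jumpP V Vb / (V 0 ^ 2 * lorentz V) * Z 0 +
      jumpU V Vb * lorentz V * V 1 * dEnthalpy Γ V Z +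
      jumpU V Vb * enthalpy Γ V * lorentz V * Z 1 +
      jumpP V Vb / (Vb 0 ^ 2 * lorentz Vb) * Y 0 +
      jumpP V Vb / (Vb 0 * lorentz Vb ^ 2) * dLorentz Vb Y -
      jumpU V Vb * (dEnthalpy Γ Vb Y * lorentz Vb * Vb 1 +
          enthalpy Γ Vb * dLorentz Vb Y * Vb 1 + enthalpy Γ Vb * lorentz Vb * Y 1) = 0 := by
    rw [e1]
    linear_combination hn
  have n2 : (Z 3 - Y 3) * jumpTau V Vb + (Z 1 - Y 1) * jumpM Γ V Vb +
      (psiW Γ V Vb * lorU V + jumpU V Vb * enthalpy Γ V * lorentz V) * Z 1 +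
      psiRho Γ V Vb * Z 0 + psiH Γ V Vb * enthP Γ V * Z 3 +
      (jumpP V Vb / (Vb 0 ^ 2 * lorentz Vb)) * Y 0 + psiHB Γ V Vb * dEnthalpy Γ Vb Y +
      psiWB Γ V Vb * dLorentz Vb Y + psiW Γ V Vb * lorQ Γ V * enthalpy Γ Vb * lorentz Vb * Y 2 -
        jumpU V Vb * enthalpy Γ Vb * lorentz Vb * Y 1 = 0 := by
    linear_combination n1 - psiW Γ V Vb * hW + Z 0 * e3 +
      (enthRho Γ V * Z 0 + enthP Γ V * Z 3) * e2 + dEnthalpy Γ Vb Y * e5 +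
      dLorentz Vb Y * e4 - (jumpU V Vb * lorentz V * V 1 + psiW Γ V Vb * lorH Γ V) * hh
  rw [hWb, hhb] at n2
  linear_combination n2 - psiRho Γ V Vb * hZ0

end

section


variable {Γ s T R : ℝ} {k : State} {S O : Set (ℝ × ℝ)} {V : ℝ × ℝ → State} {z : ℝ × ℝ}
  {X Y : ℝ → ℝ}

/-! ### Regions -/

lemma isOpen_openRegion (hX : ContinuousOn X (Ico 0 T)) (hY : ContinuousOn Y (Ico 0 T)) :
    IsOpen (openRegion T X Y) := by
  have hA : IsOpen {z : ℝ × ℝ | z.1 ∈ Ioo 0 T} := isOpen_Ioo.preimage continuous_fst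
  have hm : MapsTo (Prod.fst : ℝ × ℝ → ℝ) {z : ℝ × ℝ | z.1 ∈ Ioo 0 T} (Ico 0 T) :=
    fun z hz => Ioo_subset_Ico_self hz
  have hXc := hX.comp continuous_fst.continuousOn hm
  have hYc := hY.comp continuous_fst.continuousOn hm
  have h1 := (continuous_snd.continuousOn.sub hXc).isOpen_inter_preimage hA (isOpen_Ioi (a := 0))
  have h2 := (hYc.sub continuous_snd.continuousOn).isOpen_inter_preimage hA (isOpen_Ioi (a := 0))
  convert h1.inter h2 using 1
  ext z
  simp [openRegion]
  tauto

lemma openRegion_subset : openRegion T X Y ⊆ closedRegion T X Y :=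
  fun _ hz => ⟨hz.1.le, hz.2.1, hz.2.2.1.le, hz.2.2.2.le⟩

lemma openRight_subset : openRight T R X ⊆ closedRight T R X :=
  fun _ hz => ⟨hz.1.le, hz.2.1, hz.2.2.1.le, hz.2.2.2⟩

/-- A region contains points close to the origin if it contains those of a curve `x = p t`. -/
lemma neBot_nhdsWithin_of_curve {p : ℝ → ℝ} (hT : 0 < T) (h0 : p 0 = 0)
    (hp : ContinuousWithinAt p (Ico 0 T) 0) (hO : ∀ᶠ t in 𝓝[Ioo 0 T] 0, (t, p t) ∈ O) :
    (𝓝[O] ((0 : ℝ), (0 : ℝ))).NeBot := by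
  have : (𝓝[Ioo 0 T] (0 : ℝ)).NeBot := left_nhdsWithin_Ioo_neBot hT
  have h1 : Tendsto p (𝓝[Ioo 0 T] 0) (𝓝 0) := by
    have := hp.mono_left (nhdsWithin_mono 0 Ioo_subset_Ico_self)
    rwa [h0] at this
  have h2 : Tendsto (fun t => (t, p t)) (𝓝[Ioo 0 T] 0) (𝓝 ((0 : ℝ), (0 : ℝ))) :=
    (tendsto_id.mono_left nhdsWithin_le_nhds).prodMk_nhds h1
  exact (tendsto_nhdsWithin_iff.2 ⟨h2, hO⟩).neBot

lemma neBot_nhdsWithin_openRegion (hT : 0 < T) (hX0 : X 0 = 0) (hY0 : Y 0 = 0)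
    (hX : ContinuousOn X (Ico 0 T)) (hY : ContinuousOn Y (Ico 0 T))
    (h : ∀ t ∈ Ioo 0 T, X t < Y t) : (𝓝[openRegion T X Y] ((0 : ℝ), (0 : ℝ))).NeBot := by
  have h0 : (0 : ℝ) ∈ Ico 0 T := ⟨le_rfl, hT⟩
  refine neBot_nhdsWithin_of_curve (p := fun t => (X t + Y t) / 2) hT (by simp [hX0, hY0])
    (((hX 0 h0).add (hY 0 h0)).div_const 2) ?_
  filter_upwards [self_mem_nhdsWithin] with t ht
  have := h t ht
  exact ⟨ht.1, ht.2, by simp only; linarith, by simp only; linarith⟩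

lemma neBot_nhdsWithin_openRight (hT : 0 < T) (hR : 0 < R) (hX0 : X 0 = 0)
    (hX : ContinuousOn X (Ico 0 T)) : (𝓝[openRight T R X] ((0 : ℝ), (0 : ℝ))).NeBot := by
  have h0 : (0 : ℝ) ∈ Ico 0 T := ⟨le_rfl, hT⟩
  have hp : ContinuousWithinAt (fun t => X t + t) (Ico 0 T) 0 :=
    (hX 0 h0).add continuousWithinAt_id
  refine neBot_nhdsWithin_of_curve hT (by simp [hX0]) hp ?_
  have h1 : ∀ᶠ t in 𝓝[Ioo 0 T] 0, X t + t < R :=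
    (hp.mono Ioo_subset_Ico_self).eventually_lt_const (by simpa [hX0])
  filter_upwards [self_mem_nhdsWithin, h1] with t ht ht'
  exact ⟨ht.1, ht.2, by simpa using ht.1, ht'⟩

/-! ### Smooth pieces at a boundary point -/

/-- The derivative of a function which is `C¹` up to the boundary has limits at the boundary. -/
lemma exists_hasFDerivWithinAt_tendsto {E F : Type*} [NormedAddCommGroup E] [NormedSpace ℝ E]
    [NormedAddCommGroup F] [NormedSpace ℝ F] {f : E → F} {S O : Set E} {z : E}
    (hf : ContDiffOn ℝ 1 f S) (hz : z ∈ S) (hO : IsOpen O) (hOS : O ⊆ S) :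
    ∃ L : E →L[ℝ] F, HasFDerivWithinAt f L S z ∧ Tendsto (fderiv ℝ f) (𝓝[O] z) (𝓝 L) := by
  have h := hf z hz
  rw [← zero_add (1 : WithTop ℕ∞),
    contDiffWithinAt_succ_iff_hasFDerivWithinAt (by simp), insert_eq_of_mem hz] at h
  obtain ⟨u, hu, -, f', hf', hc⟩ := h
  have hzu : z ∈ u := mem_of_mem_nhdsWithin hz hu
  refine ⟨f' z, (hf' z hzu).mono_of_mem_nhdsWithin hu, ?_⟩
  have huO : u ∈ 𝓝[O] z := nhdsWithin_mono z hOS hu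
  have ht : Tendsto f' (𝓝[O] z) (𝓝 (f' z)) :=
    hc.continuousWithinAt.mono_left (nhdsWithin_le_of_mem huO)
  refine ht.congr' ?_
  obtain ⟨o, ho, hzo, hou⟩ := mem_nhdsWithin.1 huO
  -- At points of the open set close to `z` the set `u` is a full neighbourhood, so there `f'` is
  -- the ordinary derivative. Nothing is assumed on the shape of `S` at `z`, which may be a cusp.
  filter_upwards [inter_mem_nhdsWithin O (ho.mem_nhds hzo)] with y hy
  have hyu : u ∈ 𝓝 y := mem_of_superset ((ho.inter hO).mem_nhds ⟨hy.2, hy.1⟩) hou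
  exact ((hf' y (mem_of_mem_nhds hyu)).hasFDerivAt hyu).fderiv.symm

lemma IsSmoothPiece.differentiableAt (h : IsSmoothPiece Γ k S O V) (hO : IsOpen O) (hOS : O ⊆ S)
    (hz : z ∈ O) : DifferentiableAt ℝ V z :=
  ((h.1 z (hOS hz)).contDiffAt (mem_of_superset (hO.mem_nhds hz) hOS)).differentiableAt one_ne_zero

lemma tendsto_clm_apply {ι E F : Type*} [NormedAddCommGroup E] [NormedSpace ℝ E]
    [NormedAddCommGroup F] [NormedSpace ℝ F] {l : Filter ι} {A : ι → E →L[ℝ] F} {x : ι → E}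
    {A₀ : E →L[ℝ] F} {x₀ : E} (hA : Tendsto A l (𝓝 A₀)) (hx : Tendsto x l (𝓝 x₀)) :
    Tendsto (fun i => A i (x i)) l (𝓝 (A₀ x₀)) :=
  (isBoundedBilinearMap_apply.continuous.tendsto (A₀, x₀)).comp (hA.prodMk_nhds hx)

/-- The balance law at a boundary point. -/
lemma IsSmoothPiece.balance (hΓ : 1 < Γ) (h : IsSmoothPiece Γ k S O V) (hO : IsOpen O)
    (hOS : O ⊆ S) (hz : z ∈ S) (hne : (𝓝[O] z).NeBot) {L : ℝ × ℝ →L[ℝ] State}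
    (hL : Tendsto (fderiv ℝ V) (𝓝[O] z) (𝓝 L)) :
    dConserved Γ (V z) (L (1, 0)) + dFlux Γ (V z) (L (0, 1)) = k := by
  have hVz := h.2.1 z hz
  have hV : Tendsto V (𝓝[O] z) (𝓝 (V z)) :=
    (h.1.continuousOn z hz).mono_left (nhdsWithin_mono z hOS)
  have hU := ((contDiffAt_conserved hΓ hVz).continuousAt_fderiv one_ne_zero).tendsto.comp hV
  have hF := ((contDiffAt_flux hΓ hVz).continuousAt_fderiv one_ne_zero).tendsto.comp hV
  have h1 := tendsto_clm_apply hU (tendsto_clm_apply hL (tendsto_const_nhds (x := ((1 : ℝ), (0 : ℝ)))))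
  have h2 := tendsto_clm_apply hF (tendsto_clm_apply hL (tendsto_const_nhds (x := ((0 : ℝ), (1 : ℝ)))))
  -- By the chain rule the balance law says that the sum of the two convergent expressions is
  -- constantly `k` on `O`. Uniqueness of limits needs `z` to be a limit of points of `O`.
  rw [← fderiv_conserved hΓ hVz, ← fderiv_flux hΓ hVz]
  refine tendsto_nhds_unique (h1.add h2) (tendsto_const_nhds.congr' ?_)
  filter_upwards [self_mem_nhdsWithin] with y hy
  have hVy := h.2.1 y (hOS hy)
  have hd := (h.differentiableAt hO hOS hy).hasFDerivAt
  have e1 := (((contDiffAt_conserved hΓ hVy).differentiableAt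
    one_ne_zero).hasFDerivAt.comp y hd).fderiv
  have e2 := (((contDiffAt_flux hΓ hVy).differentiableAt
    one_ne_zero).hasFDerivAt.comp y hd).fderiv
  rw [← h.2.2 y hy]
  exact congrArg₂ (· + ·) (congrArg (fun A : ℝ × ℝ →L[ℝ] State => A (1, 0)) e1)
    (congrArg (fun A : ℝ × ℝ →L[ℝ] State => A (0, 1)) e2)

lemma IsSmoothPiece.tendsto_materialDeriv (h : IsSmoothPiece Γ k S O V) (hO : IsOpen O)
    (hOS : O ⊆ S) (hz : z ∈ S) {L : ℝ × ℝ →L[ℝ] State}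
    (hL : Tendsto (fderiv ℝ V) (𝓝[O] z) (𝓝 L)) (i : Fin 4) :
    Tendsto (materialDeriv V i) (𝓝[O] z) (𝓝 (L (1, V z 1) i)) := by
  have hV : Tendsto (fun y => V y 1) (𝓝[O] z) (𝓝 (V z 1)) :=
    tendsto_pi_nhds.1 ((h.1.continuousOn z hz).mono_left (nhdsWithin_mono z hOS)) 1
  have h1 := tendsto_pi_nhds.1
    (tendsto_clm_apply hL ((tendsto_const_nhds (x := (1 : ℝ))).prodMk_nhds hV)) i
  refine h1.congr' ?_
  filter_upwards [self_mem_nhdsWithin] with y hy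
  have hd := (h.differentiableAt hO hOS hy).hasFDerivAt
  unfold materialDeriv
  rw [(hasFDerivAt_pi'.1 hd i).fderiv]
  rfl

/-- The derivative along a curve in the closure of a smooth piece. -/
lemma hasDerivWithinAt_curve {x' : ℝ} (h0 : X 0 = 0)
    (hX : HasDerivWithinAt X x' (Ico 0 T) 0) {L : ℝ × ℝ →L[ℝ] State}
    (hV : HasFDerivWithinAt V L S (0, 0)) (hS : ∀ t ∈ Ico 0 T, (t, X t) ∈ S) :
    HasDerivWithinAt (fun t => V (t, X t)) (L (1, x')) (Ico 0 T) 0 := by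
  have hc : HasDerivWithinAt (fun t => (t, X t)) (1, x') (Ico 0 T) 0 :=
    (hasDerivWithinAt_id 0 _).prodMk hX
  exact HasFDerivWithinAt.comp_hasDerivWithinAt (0 : ℝ) (by rwa [h0]) hc hS

lemma map_one_eq (L : ℝ × ℝ →L[ℝ] State) (r : ℝ) (i : Fin 4) :
    L (1, r) i = L (1, 0) i + r * L (0, 1) i := by
  have : ((1 : ℝ), r) = (1, 0) + r • ((0 : ℝ), (1 : ℝ)) := by simp
  rw [this, map_add, map_smul]
  rfl

end

/-! ### Shock relations differentiated at the origin -/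

section


lemma continuousWithinAt_curveSpeed {T : ℝ} {X : ℝ → ℝ} (hT : 0 < T)
    (hX : ContDiffOn ℝ 1 X (Ico 0 T)) : ContinuousWithinAt (curveSpeed T X) (Ico 0 T) 0 :=
  hX.continuousOn_derivWithin (uniqueDiffOn_Ico 0 T) le_rfl 0 ⟨le_rfl, hT⟩

lemma hasDerivWithinAt_curveSpeed {T : ℝ} {X : ℝ → ℝ} (hT : 0 < T)
    (hX : ContDiffOn ℝ 1 X (Ico 0 T)) : HasDerivWithinAt X (curveSpeed T X 0) (Ico 0 T) 0 :=
  ((hX.differentiableOn one_ne_zero) 0 ⟨le_rfl, hT⟩).hasDerivWithinAt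

/-- Continuity of the states and of the shock speed keeps the shock in the neighbourhood where `Ψ`
vanishes for small `t`. So `Ψ` is zero along it, and the one-sided chain rule at `t = 0` applies. -/
lemma shockRelation_deriv {Γ s : ℝ} {T : ℝ} {γ β : ℝ → State} {σ : ℝ → ℝ} {Z Y : State}
    (hT : 0 < T) (hγ : HasDerivWithinAt γ Z (Ico 0 T) 0)
    (hβ : HasDerivWithinAt β Y (Ico 0 T) 0) (hσ : ContinuousWithinAt σ (Ico 0 T) 0)
    (hs : σ 0 = s) (hshock : ∀ t ∈ Ico 0 T, IsRightShock Γ (σ t) (γ t) (β t))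
    {Ψ : ℝ × ℝ × State → ℝ} (hΨ : IsShockRelation Γ s (γ 0) (β 0) Ψ)
    {Ψ' : ℝ × ℝ × State →L[ℝ] ℝ} (hd : HasFDerivAt Ψ Ψ' (γ 0 1, γ 0 3, β 0)) :
    Ψ' (1, 0, 0) * Z 1 + Ψ' (0, 1, 0) * Z 3 = -Ψ' (0, 0, Y) := by
  have h0 : (0 : ℝ) ∈ Ico 0 T := ⟨le_rfl, hT⟩
  have hz := hasDerivWithinAt_pi.1 hγ
  have hc : HasDerivWithinAt (fun t => (γ t 1, γ t 3, β t)) (Z 1, Z 3, Y) (Ico 0 T) 0 :=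
    (hz 1).prodMk ((hz 3).prodMk hβ)
  have hcomp : HasDerivWithinAt (fun t => Ψ (γ t 1, γ t 3, β t)) (Ψ' (Z 1, Z 3, Y))
      (Ico 0 T) 0 := HasFDerivAt.comp_hasDerivWithinAt (0 : ℝ) hd hc
  have hq : Tendsto (fun t => (γ t, β t, σ t)) (𝓝[Ico 0 T] 0) (𝓝 (γ 0, β 0, s)) := by
    rw [← hs]
    exact hγ.continuousWithinAt.tendsto.prodMk_nhds
      (hβ.continuousWithinAt.tendsto.prodMk_nhds hσ)
  have hev : (fun t => Ψ (γ t 1, γ t 3, β t)) =ᶠ[𝓝[Ico 0 T] 0] fun _ => 0 := by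
    filter_upwards [hq.eventually hΨ, self_mem_nhdsWithin] with t ht ht'
    exact ht (hshock t ht')
  have hzero : Ψ' (Z 1, Z 3, Y) = 0 :=
    (uniqueDiffOn_Ico 0 T 0 h0).eq_deriv _ hcomp
      ((hasDerivWithinAt_const (0 : ℝ) (Ico 0 T) (0 : ℝ)).congr_of_eventuallyEq_of_mem hev h0)
  have hsplit : ((Z 1, Z 3, Y) : ℝ × ℝ × State) =
      Z 1 • (1, 0, 0) + Z 3 • (0, 1, 0) + (0, 0, Y) := by simp
  rw [hsplit, map_add, map_add, map_smul, map_smul, smul_eq_mul, smul_eq_mul] at hzero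
  linear_combination hzero

lemma shock_deriv {Γ : ℝ} (hΓ : 1 < Γ) (hΓ' : Γ ≤ 2) {T : ℝ} {γ β : ℝ → State} {σ : ℝ → ℝ}
    {Z Y : State} (hT : 0 < T) (hγ : HasDerivWithinAt γ Z (Ico 0 T) 0)
    (hβ : HasDerivWithinAt β Y (Ico 0 T) 0) (hV : ∀ t ∈ Ico 0 T, Admissible (γ t))
    (hVb : ∀ t ∈ Ico 0 T, Admissible (β t))
    (hshock : ∀ t ∈ Ico 0 T, IsRightShock Γ (σ t) (γ t) (β t)) :
    coefAu Γ (γ 0) (β 0) * Z 1 + coefAp Γ (γ 0) (β 0) * Z 3 = coefArhs Γ (γ 0) (β 0) Y := by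
  have h0 : (0 : ℝ) ∈ Ico 0 T := ⟨le_rfl, hT⟩
  have hu := uniqueDiffOn_Ico 0 T 0 h0
  exact coefAu_mul_add_coefAp_mul hΓ hΓ' (hV 0 h0) (hVb 0 h0)
    (deriv_taub hΓ (hV 0 h0) (hVb 0 h0) hγ hβ hu h0
      fun t ht => (hshock t ht).taub (hV t ht) (hVb t ht))
    (deriv_transverse hΓ (hV 0 h0) (hVb 0 h0) hγ hβ hu h0
      fun t ht => (hshock t ht).transverse (hV t ht))
    (deriv_normal hΓ (hV 0 h0) (hVb 0 h0) hγ hβ hu h0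
      fun t ht => (hshock t ht).normal (hV t ht) (hVb t ht))

end

end RHD

end

/-! ### The linear relation at the origin -/

theorem mainTheorem2 (Γ : ℝ) (hΓ : 1 < Γ) (hΓ' : Γ ≤ 2) (k : RHD.State)
    (V₀ : ℝ → RHD.State) (V₀x : RHD.State) (hV₀ : HasDerivWithinAt V₀ V₀x (Set.Ici 0) 0)
    (T R : ℝ) (Xl Xc Xs : ℝ → ℝ) (VL VR Vr : ℝ × ℝ → RHD.State)
    (hsol : RHD.IsGRPSolutionRightShock Γ k V₀ T R Xl Xc Xs VL VR Vr)
    (s : ℝ) (hs : s = RHD.curveSpeed T Xs 0)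
    (Vstar Vb : RHD.State) (hVstar : Vstar = VR (0, 0)) (hVb : Vb = V₀ 0) :
    ∃ DuDt DpDt : ℝ,
      Tendsto (RHD.materialDeriv VL 1) (𝓝[RHD.openRegion T Xl Xc] (0, 0)) (𝓝 DuDt) ∧
      Tendsto (RHD.materialDeriv VR 1) (𝓝[RHD.openRegion T Xc Xs] (0, 0)) (𝓝 DuDt) ∧
      Tendsto (RHD.materialDeriv VL 3) (𝓝[RHD.openRegion T Xl Xc] (0, 0)) (𝓝 DpDt) ∧
      Tendsto (RHD.materialDeriv VR 3) (𝓝[RHD.openRegion T Xc Xs] (0, 0)) (𝓝 DpDt) ∧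
      RHD.coefAR Γ s Vstar (RHD.coefAu Γ Vstar Vb) (RHD.coefAp Γ Vstar Vb) * DuDt +
          RHD.coefBR Γ s Vstar (RHD.coefAu Γ Vstar Vb) (RHD.coefAp Γ Vstar Vb) * DpDt =
        RHD.coefDR Γ s k Vstar (RHD.coefAu Γ Vstar Vb) (RHD.coefAp Γ Vstar Vb)
          (RHD.coefArhs Γ Vstar Vb (RHD.aheadDs Γ k s Vb V₀x)) ∧
      ∀ Ψ : ℝ × ℝ × RHD.State → ℝ,
        RHD.IsShockRelation Γ s Vstar Vb Ψ →
        ∀ Ψ' : ℝ × ℝ × RHD.State →L[ℝ] ℝ,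
          HasFDerivAt Ψ Ψ' (Vstar 1, Vstar 3, Vb) →
          RHD.coefAR Γ s Vstar (Ψ' (1, 0, 0)) (Ψ' (0, 1, 0)) * DuDt +
              RHD.coefBR Γ s Vstar (Ψ' (1, 0, 0)) (Ψ' (0, 1, 0)) * DpDt =
            RHD.coefDR Γ s k Vstar (Ψ' (1, 0, 0)) (Ψ' (0, 1, 0))
              (-Ψ' (0, 0, RHD.aheadDs Γ k s Vb V₀x)) := by
  open RHD in
  have hT := hsol.T_pos
  have h0 : (0 : ℝ) ∈ Ico 0 T := ⟨le_rfl, hT⟩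
  have hR : 0 < R := by simpa [hsol.Xs_zero] using hsol.Xs_lt_R 0 h0
  have hXc := hsol.Xc_smooth.continuousOn
  have hXs := hsol.Xs_smooth.continuousOn
  have hlc : ∀ t ∈ Ico 0 T, Xl t ≤ Xc t := fun t ht => by
    rcases ht.1.eq_or_lt with h | h
    · rw [← h, hsol.Xl_zero, hsol.Xc_zero]
    · exact (hsol.Xl_lt_Xc t ⟨h, ht.2⟩).le
  have hcs : ∀ t ∈ Ico 0 T, Xc t ≤ Xs t := fun t ht => by
    rcases ht.1.eq_or_lt with h | h
    · rw [← h, hsol.Xc_zero, hsol.Xs_zero]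
    · exact (hsol.Xc_lt_Xs t ⟨h, ht.2⟩).le
  -- the curves lie on the boundaries of the regions
  have hcL : ∀ t ∈ Ico 0 T, (t, Xc t) ∈ closedRegion T Xl Xc :=
    fun t ht => ⟨ht.1, ht.2, hlc t ht, le_rfl⟩
  have hcR : ∀ t ∈ Ico 0 T, (t, Xc t) ∈ closedRegion T Xc Xs :=
    fun t ht => ⟨ht.1, ht.2, le_rfl, hcs t ht⟩
  have hsR : ∀ t ∈ Ico 0 T, (t, Xs t) ∈ closedRegion T Xc Xs :=
    fun t ht => ⟨ht.1, ht.2, hcs t ht, le_rfl⟩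
  have hsr : ∀ t ∈ Ico 0 T, (t, Xs t) ∈ closedRight T R Xs :=
    fun t ht => ⟨ht.1, ht.2, le_rfl, hsol.Xs_lt_R t ht⟩
  have hzL := hcL 0 h0
  have hzR := hcR 0 h0
  have hzr := hsr 0 h0
  rw [hsol.Xc_zero] at hzL hzR
  rw [hsol.Xs_zero] at hzr
  have hOL := isOpen_openRegion hsol.Xl_cont hXc
  have hOR := isOpen_openRegion hXc hXs
  -- `openRight` is by definition the region bounded on the right by the constant curve `R`.
  have hOr : IsOpen (openRight T R Xs) := isOpen_openRegion hXs continuousOn_const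
  obtain ⟨LL, hLL, hLL'⟩ := exists_hasFDerivWithinAt_tendsto hsol.left_star.1 hzL hOL
    openRegion_subset
  obtain ⟨LR, hLR, hLR'⟩ := exists_hasFDerivWithinAt_tendsto hsol.right_star.1 hzR hOR
    openRegion_subset
  obtain ⟨Lr, hLr, hLr'⟩ := exists_hasFDerivWithinAt_tendsto hsol.right_outer.1 hzr hOr
    openRight_subset
  have hu : VL (0, 0) 1 = VR (0, 0) 1 := by
    simpa [hsol.Xc_zero] using hsol.contact_velocity 0 h0
  have hXc' : HasDerivWithinAt Xc (VR (0, 0) 1) (Ico 0 T) 0 := by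
    have h1 := hasDerivWithinAt_curveSpeed hT hsol.Xc_smooth
    rw [hsol.contact_speed 0 h0, hsol.Xc_zero] at h1
    exact h1
  have hXs' : HasDerivWithinAt Xs s (Ico 0 T) 0 := by
    rw [hs]
    exact hasDerivWithinAt_curveSpeed hT hsol.Xs_smooth
  -- the material derivatives agree on both sides of the contact
  have hUD := uniqueDiffOn_Ico 0 T 0 h0
  have hdL := hasDerivWithinAt_pi.1 (hasDerivWithinAt_curve hsol.Xc_zero hXc' hLL hcL)
  have hdR := hasDerivWithinAt_pi.1 (hasDerivWithinAt_curve hsol.Xc_zero hXc' hLR hcR)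
  have hDu : LL (1, VR (0, 0) 1) 1 = LR (1, VR (0, 0) 1) 1 :=
    hUD.eq_deriv _ (hdL 1) ((hdR 1).congr hsol.contact_velocity (hsol.contact_velocity 0 h0))
  have hDp : LL (1, VR (0, 0) 1) 3 = LR (1, VR (0, 0) 1) 3 :=
    hUD.eq_deriv _ (hdL 3) ((hdR 3).congr hsol.contact_pressure (hsol.contact_pressure 0 h0))
  -- the balance law at the origin
  have hneR := neBot_nhdsWithin_openRegion hT hsol.Xc_zero hsol.Xs_zero hXc hXs hsol.Xc_lt_Xs
  have hner := neBot_nhdsWithin_openRight hT hR hsol.Xs_zero hXs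
  have hbR := hsol.right_star.balance hΓ hOR openRegion_subset hzR hneR hLR'
  have hbr := hsol.right_outer.balance hΓ hOr openRight_subset hzr hner hLr'
  -- the state ahead of the shock
  have hVb' : Vr (0, 0) = Vb := by rw [hVb, hsol.initial 0 ⟨le_rfl, hR⟩]
  have hx : Lr (0, 1) = V₀x := by
    -- The initial half-line is itself a path in the closed outer region, so `Lr (0, 1)` is the
    -- one-sided slope of the data.
    have hc : HasDerivWithinAt (fun x : ℝ => ((0 : ℝ), x)) (0, 1) (Ico 0 R) 0 :=
      (hasDerivWithinAt_const 0 _ 0).prodMk (hasDerivWithinAt_id 0 _)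
    have hm : MapsTo (fun x : ℝ => ((0 : ℝ), x)) (Ico 0 R) (closedRight T R Xs) :=
      fun x hx => ⟨le_rfl, hT, by simpa [hsol.Xs_zero] using hx.1, hx.2⟩
    have h1 := hLr.comp_hasDerivWithinAt (0 : ℝ) hc hm
    exact (uniqueDiffOn_Ico 0 R 0 ⟨le_rfl, hR⟩).eq_deriv _ h1
      ((hV₀.mono Ico_subset_Ici_self).congr hsol.initial (hsol.initial 0 ⟨le_rfl, hR⟩))
  have hY : Lr (1, s) = aheadDs Γ k s Vb V₀x := by
    have h1 := eq_primSource_sub hΓ hΓ' (hsol.right_outer.2.1 _ hzr) hbr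
    rw [hVb', hx] at h1
    ext i
    rw [map_one_eq, h1, hx]
    simp [aheadDs]
    ring
  have hγ := hasDerivWithinAt_curve hsol.Xs_zero hXs' hLR hsR
  have hβ := hasDerivWithinAt_curve hsol.Xs_zero hXs' hLr hsr
  rw [hY] at hβ
  have hstar := hsol.right_star.2.1 _ hzR
  have hne : 1 - VR (0, 0) 1 * s ≠ 0 := by
    have h1 := hsol.shock 0 h0
    rw [hsol.Xs_zero, ← hs] at h1
    exact (h1.one_sub_mul_pos hΓ hΓ' hstar).ne'
  have hrel := shock_deriv hΓ hΓ' hT hγ hβ (fun t ht => hsol.right_star.2.1 _ (hsR t ht))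
    (fun t ht => hsol.right_outer.2.1 _ (hsr t ht)) hsol.shock
  have hσ := continuousWithinAt_curveSpeed hT hsol.Xs_smooth
  subst hVstar
  -- The limits are read off on the right of the contact; `hDu`, `hDp` and `hu` transfer them to the
  -- left part.
  refine ⟨LR (1, VR (0, 0) 1) 1, LR (1, VR (0, 0) 1) 3, ?_, ?_, ?_, ?_, ?_, ?_⟩
  · rw [← hDu, ← hu]
    exact hsol.left_star.tendsto_materialDeriv hOL openRegion_subset hzL hLL' 1
  · exact hsol.right_star.tendsto_materialDeriv hOR openRegion_subset hzR hLR' 1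
  · rw [← hDp, ← hu]
    exact hsol.left_star.tendsto_materialDeriv hOL openRegion_subset hzL hLL' 3
  · exact hsol.right_star.tendsto_materialDeriv hOR openRegion_subset hzR hLR' 3
  · simp only [hsol.Xs_zero, hVb', map_one_eq LR s] at hrel
    rw [map_one_eq LR _ 1, map_one_eq LR _ 3]
    exact material_relation hΓ hΓ' hstar hne hbR hrel
  · intro Ψ hΨ Ψ' hd
    have h1 := shockRelation_deriv hT hγ hβ hσ hs.symm hsol.shock (Ψ := Ψ) (Ψ' := Ψ')
    simp only [hsol.Xs_zero, hVb', map_one_eq LR s] at h1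
    rw [map_one_eq LR _ 1, map_one_eq LR _ 3]
    exact material_relation hΓ hΓ' hstar hne hbR (h1 hΨ hd)
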